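/- Let $N\ge 2$ be an integer and let $p,\mu,s\in\mathbb R$ satisfy $1<p<N$, $-\infty<\mu<\bar\mu:=\left(\frac{N-p}{p}\right)^p$ and $0\le s<p$. Put $p^*(s)=\frac{(N-s)p}{N-p}$. Let $\mathcal D^{1,p}(\mathbb R^N)$ be the completion of $C_0^\infty(\mathbb R^N)$ in the seminorm $\|\nabla v\|_{L^p(\mathbb R^N)}$, realized as a space of functions in $L^{p^*(0)}(\mathbb R^N)$ (identified when equal almost everywhere). Consider $$-\Delta_p u-\frac{\mu}{|x|^p}|u|^{p-2}u=\frac{|u|^{p^*(s)-2}u}{|x|^s}\quad\text{in }\mathbb R^N,\qquad(\ast)$$ where $u\in\mathcal D^{1,p}(\mathbb R^N)$ is a (weak) solution if for every $\varphi\in C_0^\infty(\mathbb R^N)$ $$\int_{\mathbb R^N}\Big(|\nabla u|^{p-2}\nabla u\cdot\nabla\varphi-\frac{\mu}{|x|^p}|u|^{p-2}u\,\varphi\Big)dx=\int_{\mathbb R^N}\frac{|u|^{p^*(s)-2}u}{|x|^s}\,\varphi\,dx .$$ For $\tau>0$ let $u^\tau(x)=\tau^{\frac{N-p}{p}}u(\tau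 x)$. "Positive radial solution" means a solution in $\mathcal D^{1,p}(\mathbb R^N)$ that is positive and depends only on $|x|$, almost everywhere. (i) Up to dilation there is at most one positive radial solution of $(\ast)$: if $u_1,u_2\in\mathcal D^{1,p}(\mathbb R^N)$ are positive radial solutions, then $u_2=u_1^\tau$ almost everywhere for some $\tau>0$. (ii) The function $\Gamma_\mu(\gamma)=(p-1)|\gamma|^p-(N-p)|\gamma|^{p-2}\gamma+\mu$ has exactly two real zeros $\gamma_1<\gamma_2$. Every positive radial solution $u$ of $(\ast)$ has a representative, again denoted $u$, that is continuously differentiable on $\mathbb R^N\setminus\{0\}$, and there are constants $C_1,C_2>0$ with $$\lim_{|x|\to0}u(x)|x|^{\gamma_1}=C_1,\qquad \lim_{|x|\to\infty}u(x)|x|^{\gamma_2}=C_2,$$ $$\lim_{|x|\to0}|\nabla u(x)||x|^{\gamma_1+1}=|\gamma_1|C_1,\qquad \lim_{|x|\to\infty}|\nabla u(x)||x|^{\gamma_2+1}=\gamma_2C_2 .$$ Up to dilation the constants depend only on $N,p,\mu,s$: there are $C_1,C_2>0$, depending only on $N,p,\mu,s$, such that every positive radial solution $u$ of $(\ast)$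 has a dilation $u^\tau$, $\tau>0$, that satisfies these four limits with these $C_1,C_2$. -/

import Mathlib

open MeasureTheory Filter Topology
open scoped ContDiff

namespace HardySobolev

/-- The space `ℝ^N` with its Euclidean norm. -/
abbrev Space (N : ℕ) : Type := EuclideanSpace ℝ (Fin N)

/-- The critical exponent `p^*(s) = (N - s) p / (N - p)`. -/
noncomputable def critExp (N : ℕ) (p s : ℝ) : ℝ := ((N : ℝ) - s) * p / ((N : ℝ) - p)

/-- `Γ_μ(γ) = (p - 1) |γ|^p - (N - p) |γ|^(p-2) γ + μ`. -/
noncomputable def Gam (N : ℕ) (p μ γ : ℝ) : ℝ :=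
  (p - 1) * |γ| ^ p - ((N : ℝ) - p) * (|γ| ^ (p - 2) * γ) + μ

/-- Test functions: the smooth real functions on `ℝ^N` with compact support. -/
def IsTest {N : ℕ} (φ : Space N → ℝ) : Prop :=
  ContDiff ℝ ∞ φ ∧ HasCompactSupport φ

/-- `u` belongs to `D^{1,p}(ℝ^N)`, the completion of the test functions in the seminorm
`‖∇φ‖_{L^p}`, and `G` is its (weak) gradient. For `1 < p < N` a sequence of test functions that is
Cauchy in this seminorm converges in `L^{p^*}`, where `p^* = p^*(0) = N p / (N - p)`, by the
Sobolev inequality; the completion is realized as the space of these limits `u`, and `G` is the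
limit of the gradients in `L^p`. -/
def MemD1p {N : ℕ} (p : ℝ) (u : Space N → ℝ) (G : Space N → Space N) : Prop :=
  MemLp u (ENNReal.ofReal (critExp N p 0)) volume ∧
  MemLp G (ENNReal.ofReal p) volume ∧
  ∃ φ : ℕ → Space N → ℝ, (∀ n, IsTest (φ n)) ∧
    Tendsto (fun n => eLpNorm (fun x => φ n x - u x)
      (ENNReal.ofReal (critExp N p 0)) volume) atTop (𝓝 0) ∧
    Tendsto (fun n => eLpNorm (fun x => gradient (φ n) x - G x)
      (ENNReal.ofReal p) volume) atTop (𝓝 0)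

/-- `u ∈ D^{1,p}(ℝ^N)` is a weak solution of
`-Δ_p u - μ |x|^{-p} |u|^{p-2} u = |x|^{-s} |u|^{p^*(s)-2} u` in `ℝ^N`. -/
def IsWeakSol {N : ℕ} (p μ s : ℝ) (u : Space N → ℝ) : Prop :=
  ∃ G : Space N → Space N, MemD1p p u G ∧
    ∀ φ : Space N → ℝ, IsTest φ →
      ∫ x, (‖G x‖ ^ (p - 2) * inner ℝ (G x) (gradient φ x)
          - μ / ‖x‖ ^ p * (|u x| ^ (p - 2) * u x) * φ x) =
        ∫ x, |u x| ^ (critExp N p s - 2) * u x / ‖x‖ ^ s * φ x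

/-- Positive radial weak solutions in `D^{1,p}(ℝ^N)`. As elements of `D^{1,p}(ℝ^N)` are functions
up to equality almost everywhere, so are positivity and radial symmetry about the origin. -/
structure IsPosRadialSol {N : ℕ} (p μ s : ℝ) (u : Space N → ℝ) : Prop where
  weakSol : IsWeakSol p μ s u
  pos : ∀ᵐ x, 0 < u x
  radial : ∃ f : ℝ → ℝ, ∀ᵐ x, u x = f ‖x‖

/-- The dilation `u^τ(x) = τ^((N-p)/p) u(τ x)`. -/
noncomputable def dilation {N : ℕ} (p τ : ℝ) (u : Space N → ℝ) : Space N → ℝ :=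
  fun x => τ ^ (((N : ℝ) - p) / p) * u (τ • x)

/-- The asymptotics of `u` and `∇u` at the origin and at infinity, read on the representative `v`
of `u` that is continuously differentiable away from the origin. -/
def HasAsymptotics {N : ℕ} (γ₁ γ₂ C₁ C₂ : ℝ) (u : Space N → ℝ) : Prop :=
  ∃ v : Space N → ℝ, (∀ᵐ x, v x = u x) ∧ ContDiffOn ℝ 1 v {0}ᶜ ∧
    Tendsto (fun x => v x * ‖x‖ ^ γ₁) (𝓝[≠] 0) (𝓝 C₁) ∧
    Tendsto (fun x => v x * ‖x‖ ^ γ₂) (Bornology.cobounded (Space N)) (𝓝 C₂) ∧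
    Tendsto (fun x => ‖gradient v x‖ * ‖x‖ ^ (γ₁ + 1)) (𝓝[≠] 0) (𝓝 (|γ₁| * C₁)) ∧
    Tendsto (fun x => ‖gradient v x‖ * ‖x‖ ^ (γ₂ + 1)) (Bornology.cobounded (Space N))
      (𝓝 (γ₂ * C₂))

end HardySobolev

/-! Put `δ = (N - p)/p`, `q = p^*(s)`, and let `p'` be conjugate to `p`. For a radial profile `F`
with derivative `D`, the Emden-Fowler variables `y(t) = e^{δt} F(e^t)` and `z(t) = -e^{-δt} r^{N-1}
|D|^{p-2} D`, with `r = e^t`, turn the equation into an autonomous Hamiltonian system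
(`IsProfile.isOrbit`); dilations become translations of `t`. The energy `δyz - |z|^{p'}/p' -
μ|y|^p/p - |y|^q/q` is conserved. Since the solution has finite norms and `1/r` is not integrable on
the half line, the orbit comes arbitrarily close to the origin, so the energy is zero.

On the zero level the slope `w = z / y^{p-1}` decouples. With `Φ(w) = δw - |w|^{p'}/p' - μ/p` one
gets `Φ(w) = y^{q-p}/q` (`phi_slope`) and `w' = (q - p) Φ(w)` (`hasDerivAt_slope`). The function `Φ`
is concave with maximum `(δ^p - μ)/p`, positive exactly because `μ < δ^p`; it has two zeros `w₁ <
w₂`, and `w` increases from `w₁` to `w₂`. Uniqueness for this scalar equation gives uniqueness up to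
translation (`eq_translate`), as `y` is recovered from `Φ(w)`. The approach to the zeros is
exponential, so `y'/y = δ - |w|^{p'-2} w` differs from its limit by an integrable function, and `y`
is asymptotic to a pure exponential (`tendsto_atTop`, `tendsto_atBot`). The exponents are `γ_i =
|w_i|^{p'-2} w_i`, because `Γ_μ(γ) = -p Φ(|γ|^{p-2} γ)`.

What remains is regularity (`IsPosRadialSol.exists_profile`). Radial test functions and the du
Bois-Reymond lemma, applied to the profile and then to the flux `r^{N-1} |D|^{p-2} D`, show that a
weak radial solution has a classical profile. -/

namespace HardySobolev

/-! ### Odd powers. -/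

/-- The odd power `|x|^(a-2) x`. -/
noncomputable def dpow (a x : ℝ) : ℝ := |x| ^ (a - 2) * x

@[simp] lemma dpow_zero (a : ℝ) : dpow a 0 = 0 := by simp [dpow]

lemma dpow_of_pos {a x : ℝ} (hx : 0 < x) : dpow a x = x ^ (a - 1) := by
  rw [dpow, abs_of_pos hx, ← Real.rpow_add_one hx.ne']
  congr 1; ring

lemma dpow_of_nonneg {a x : ℝ} (ha : 1 < a) (hx : 0 ≤ x) : dpow a x = x ^ (a - 1) := by
  rcases hx.eq_or_lt with rfl | hx
  · rw [dpow_zero, Real.zero_rpow (by linarith)]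
  · exact dpow_of_pos hx

lemma dpow_neg (a x : ℝ) : dpow a (-x) = -dpow a x := by simp [dpow]

lemma dpow_pos {a x : ℝ} (hx : 0 < x) : 0 < dpow a x := by
  rw [dpow_of_pos hx]; positivity

lemma abs_dpow {a : ℝ} (ha : 1 < a) (x : ℝ) : |dpow a x| = |x| ^ (a - 1) := by
  rw [← dpow_of_nonneg ha (abs_nonneg x), dpow, dpow, abs_mul, abs_abs,
    abs_of_nonneg (Real.rpow_nonneg (abs_nonneg x) _)]

lemma mul_dpow {a : ℝ} (ha : 1 < a) (x : ℝ) : x * dpow a x = |x| ^ a := by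
  rcases eq_or_ne x 0 with rfl | hx
  · simp [Real.zero_rpow (by linarith : a ≠ 0)]
  · have h : |x| ^ a = |x| ^ (a - 2) * |x| ^ (2 : ℝ) := by
      rw [← Real.rpow_add (abs_pos.2 hx)]; congr 1; ring
    rw [h, dpow, Real.rpow_two, sq_abs]; ring

lemma dpow_mul {a c : ℝ} (hc : 0 < c) (x : ℝ) : dpow a (c * x) = c ^ (a - 1) * dpow a x := by
  rw [← dpow_of_pos hc, dpow, dpow, dpow, abs_mul, Real.mul_rpow (abs_nonneg _) (abs_nonneg _)]
  ring

lemma conj_sub_one_mul {p p' : ℝ} (h : p.HolderConjugate p') : (p - 1) * (p' - 1) = 1 := by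
  have := h.mul_eq_add
  linarith

/-- Conjugate exponents satisfy `(p - 1)(p' - 1) = 1`, which makes the two odd powers mutually
inverse. -/
lemma dpow_dpow {p p' : ℝ} (h : p.HolderConjugate p') (x : ℝ) : dpow p' (dpow p x) = x := by
  have key : ∀ x : ℝ, 0 < x → dpow p' (dpow p x) = x := fun x hx => by
    rw [dpow_of_pos (dpow_pos hx), dpow_of_pos hx, ← Real.rpow_mul hx.le, conj_sub_one_mul h,
      Real.rpow_one]
  rcases lt_trichotomy x 0 with hx | rfl | hx
  · have := key (-x) (by linarith)
    rw [dpow_neg, dpow_neg] at this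
    linarith
  · simp
  · exact key x hx

lemma abs_dpow_rpow {p p' : ℝ} (h : p.HolderConjugate p') (x : ℝ) :
    |dpow p x| ^ p' = |x| ^ p := by
  rw [← mul_dpow h.symm.lt, dpow_dpow h, mul_comm, mul_dpow h.lt]

lemma hasDerivAt_abs_rpow_div {a : ℝ} (ha : 1 < a) (x : ℝ) :
    HasDerivAt (fun x : ℝ => |x| ^ a / a) (dpow a x) x := by
  have := (hasDerivAt_abs_rpow x ha).div_const a
  have h0 : a ≠ 0 := by linarith
  have e : a * |x| ^ (a - 2) * x / a = dpow a x := by unfold dpow; field_simp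
  rwa [e] at this

lemma strictMono_dpow {a : ℝ} (ha : 1 < a) : StrictMono (dpow a) := by
  have h0 : StrictMonoOn (dpow a) (Set.Ici 0) := fun x hx y hy hxy => by
    rw [dpow_of_nonneg ha hx, dpow_of_nonneg ha hy]
    exact Real.rpow_lt_rpow hx hxy (by linarith)
  intro x y hxy
  rcases le_total 0 x with hx | hx
  · exact h0 hx (hx.trans hxy.le) hxy
  rcases le_total 0 y with hy | hy
  · rcases hx.eq_or_lt with rfl | hx
    · exact h0 Set.self_mem_Ici hy hxy
    · have h1 : 0 < dpow a (-x) := dpow_pos (by linarith)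
      have h2 : 0 ≤ dpow a y := by
        rw [dpow_of_nonneg ha hy]; positivity
      rw [dpow_neg] at h1
      linarith
  · have := h0 (show (0:ℝ) ≤ -y by linarith) (show (0:ℝ) ≤ -x by linarith) (by linarith)
    rw [dpow_neg, dpow_neg] at this
    linarith

lemma continuous_dpow {a : ℝ} (ha : 1 < a) : Continuous (dpow a) := by
  have h1 : Continuous (fun x : ℝ => (max x 0) ^ (a - 1) - (max (-x) 0) ^ (a - 1)) :=
    ((continuous_id.max continuous_const).rpow_const fun _ => Or.inr (by linarith)).sub
      ((continuous_neg.max continuous_const).rpow_const fun _ => Or.inr (by linarith))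
  convert h1 using 2 with x
  have ha' : a - 1 ≠ 0 := by linarith
  rcases le_total 0 x with hx | hx
  · rw [max_eq_left hx, max_eq_right (by linarith), Real.zero_rpow ha', dpow_of_nonneg ha hx,
      sub_zero]
  · have := dpow_of_nonneg ha (show (0:ℝ) ≤ -x by linarith)
    rw [dpow_neg] at this
    rw [max_eq_right hx, max_eq_left (by linarith), Real.zero_rpow ha', ← this]
    ring

lemma contDiffAt_dpow {a x : ℝ} (hx : x ≠ 0) : ContDiffAt ℝ 1 (dpow a) x := by
  unfold dpow
  exact ((contDiffAt_abs hx).rpow_const_of_ne (abs_pos.2 hx).ne').mul contDiffAt_id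

/-- An odd power is Hölder continuous at each point. -/
lemma exists_abs_dpow_sub_le {a w₁ : ℝ} (ha : 1 < a) :
    ∃ C β ε : ℝ, 0 < C ∧ 0 < β ∧ 0 < ε ∧
      ∀ w, |w - w₁| < ε → |dpow a w - dpow a w₁| ≤ C * |w - w₁| ^ β := by
  -- At zero the odd power need not be differentiable, whence the Hölder exponent `a - 1`. This case
  -- is needed: zero is a root of `phi` when `m = 0`.
  rcases eq_or_ne w₁ 0 with rfl | hw
  · refine ⟨1, a - 1, 1, one_pos, by linarith, one_pos, fun w _ => ?_⟩
    rw [dpow_zero, sub_zero, sub_zero, abs_dpow ha, one_mul]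
  · have hd : DifferentiableAt ℝ (dpow a) w₁ := (contDiffAt_dpow hw).differentiableAt (by simp)
    obtain ⟨C, hC, hb⟩ := hd.isBigO_sub.exists_pos
    obtain ⟨ε, hε, hb⟩ := Metric.eventually_nhds_iff.1 hb.bound
    refine ⟨C, 1, ε, hC, one_pos, hε, fun w hw => ?_⟩
    rw [Real.rpow_one]
    exact hb (by rwa [Real.dist_eq])

/-! ### The concave function `phi` and its zeros. -/

/-- The concave function governing the slope `w = z / y^(p-1)`. -/
noncomputable def phi (p' δ m w : ℝ) : ℝ := δ * w - |w| ^ p' / p' - m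

lemma hasDerivAt_phi {p' : ℝ} (hp' : 1 < p') (δ m w : ℝ) :
    HasDerivAt (phi p' δ m) (δ - dpow p' w) w := by
  have := (((hasDerivAt_id w).const_mul δ).sub (hasDerivAt_abs_rpow_div hp' w)).sub_const m
  rw [mul_one] at this
  exact this

lemma continuous_phi {p' : ℝ} (hp' : 1 < p') (δ m : ℝ) : Continuous (phi p' δ m) :=
  continuous_iff_continuousAt.2 fun w => (hasDerivAt_phi hp' δ m w).continuousAt

lemma concaveOn_phi {p' : ℝ} (hp' : 1 < p') (δ m : ℝ) : ConcaveOn ℝ Set.univ (phi p' δ m) := by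
  refine Antitone.concaveOn_univ_of_deriv
    (fun w => (hasDerivAt_phi hp' δ m w).differentiableAt) ?_
  rw [funext fun w => (hasDerivAt_phi hp' δ m w).deriv]
  exact fun x y hxy => sub_le_sub_left ((strictMono_dpow hp').monotone hxy) _

/-- The derivative `δ - dpow p' w` changes sign exactly at `w = dpow p δ`, so this is the peak. -/
lemma strictAntiOn_phi {p p' : ℝ} (h : p.HolderConjugate p') (δ m : ℝ) :
    StrictAntiOn (phi p' δ m) (Set.Ici (dpow p δ)) := by
  refine strictAntiOn_of_deriv_neg (convex_Ici _) (continuous_phi h.symm.lt δ m).continuousOn ?_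
  intro w hw
  rw [interior_Ici] at hw
  have := strictMono_dpow h.symm.lt hw
  rw [dpow_dpow h] at this
  rw [(hasDerivAt_phi h.symm.lt δ m w).deriv]
  linarith

lemma strictMonoOn_phi {p p' : ℝ} (h : p.HolderConjugate p') (δ m : ℝ) :
    StrictMonoOn (phi p' δ m) (Set.Iic (dpow p δ)) := by
  refine strictMonoOn_of_deriv_pos (convex_Iic _) (continuous_phi h.symm.lt δ m).continuousOn ?_
  intro w hw
  rw [interior_Iic] at hw
  have := strictMono_dpow h.symm.lt hw
  rw [dpow_dpow h] at this
  rw [(hasDerivAt_phi h.symm.lt δ m w).deriv]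
  linarith

lemma phi_dpow {p p' : ℝ} (h : p.HolderConjugate p') (δ m γ : ℝ) :
    phi p' δ m (dpow p γ) = δ * dpow p γ - |γ| ^ p / p' - m := by
  rw [phi, abs_dpow_rpow h]

/-- The term `|w|^p'` outgrows the linear one because `p' > 1`. -/
lemma exists_phi_neg_right {p' : ℝ} (hp' : 1 < p') (δ m K : ℝ) :
    ∃ w, K < w ∧ phi p' δ m w < 0 := by
  have hT : Tendsto (fun w : ℝ => w * (w ^ (p' - 1) / p' - δ)) atTop atTop := by
    refine tendsto_id.atTop_mul_atTop₀ ?_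
    refine tendsto_atTop_add_const_right _ _ ?_
    exact (tendsto_rpow_atTop (by linarith)).atTop_div_const (by linarith)
  obtain ⟨w, hw1, hw2, hw3⟩ := ((hT.eventually_gt_atTop (-m)).and
    ((eventually_gt_atTop K).and (eventually_gt_atTop 0))).exists
  refine ⟨w, hw2, ?_⟩
  rw [phi, ← mul_dpow hp', dpow_of_pos hw3]
  have : w * (w ^ (p' - 1) / p' - δ) = w * w ^ (p' - 1) / p' - δ * w := by ring
  linarith

lemma phi_neg_arg (p' δ m w : ℝ) : phi p' δ m (-w) = phi p' (-δ) m w := by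
  simp [phi]

/-- From a positive peak the function descends to negative values on both sides: the intermediate
value theorem gives a zero on each side, and strict monotonicity there determines the sign
everywhere. The left side reduces to the right one by `w ↦ -w`, `δ ↦ -δ`. -/
lemma exists_phi_zeros {p p' δ m : ℝ} (h : p.HolderConjugate p')
    (hpos : 0 < phi p' δ m (dpow p δ)) :
    ∃ w₁ w₂, w₁ < dpow p δ ∧ dpow p δ < w₂ ∧ phi p' δ m w₁ = 0 ∧ phi p' δ m w₂ = 0 ∧
      ∀ w, 0 ≤ phi p' δ m w ↔ w ∈ Set.Icc w₁ w₂ := by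
  have hc := continuous_phi h.symm.lt δ m
  have hA := strictAntiOn_phi h δ m
  have hM := strictMonoOn_phi h δ m
  set k := dpow p δ
  obtain ⟨b, hb, hb'⟩ := exists_phi_neg_right h.symm.lt δ m k
  obtain ⟨a, ha, ha'⟩ := exists_phi_neg_right h.symm.lt (-δ) m (-k)
  rw [← phi_neg_arg] at ha'
  obtain ⟨w₂, hw₂, e₂⟩ := intermediate_value_Icc' hb.le hc.continuousOn ⟨hb'.le, hpos.le⟩
  obtain ⟨w₁, hw₁, e₁⟩ := intermediate_value_Icc (show -a ≤ k by linarith) hc.continuousOn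
    ⟨ha'.le, hpos.le⟩
  have l1 : w₁ < k := lt_of_le_of_ne hw₁.2 (by rintro rfl; linarith)
  have l2 : k < w₂ := lt_of_le_of_ne hw₂.1 (by rintro rfl; linarith)
  refine ⟨w₁, w₂, l1, l2, e₁, e₂, fun w => ?_⟩
  rcases le_total w k with hw | hw
  · rw [← e₁, hM.le_iff_le l1.le hw]
    exact ⟨fun h => ⟨h, by linarith⟩, fun h => h.1⟩
  · rw [← e₂, hA.le_iff_ge l2.le hw]
    exact ⟨fun h => ⟨by linarith, h⟩, fun h => h.2⟩

/-! ### Exponential convergence for scalar equations. -/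

/-- Exponential approach of an increasing solution of `w' = k Φ(w)`, `Φ` concave, to the zero of
`Φ` above it. -/
lemma exp_approach {Φ w : ℝ → ℝ} {k w₂ : ℝ} (hk : 0 < k) (hΦ : ConcaveOn ℝ Set.univ Φ)
    (h₂ : Φ w₂ = 0) (hw : ∀ t, HasDerivAt w (k * Φ (w t)) t) (hlt : ∀ t, w t < w₂)
    (hpos : ∀ t, 0 < Φ (w t)) :
    ∃ κ : ℝ, 0 < κ ∧ ∀ t, 0 ≤ t → w₂ - w t ≤ (w₂ - w 0) * Real.exp (-(κ * t)) := by
  have hmono : StrictMono w := strictMono_of_deriv_pos fun t => by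
    rw [(hw t).deriv]; exact mul_pos hk (hpos t)
  have h0 : 0 < w₂ - w 0 := sub_pos.2 (hlt 0)
  -- By concavity `Φ` lies above its chord from `w 0` to `w₂`, whose slope is `-c`; hence `w₂ - w`
  -- decays at rate at least `k * c`.
  set c := Φ (w 0) / (w₂ - w 0) with hc
  have hcpos : 0 < c := div_pos (hpos 0) h0
  have hlow : ∀ t, 0 ≤ t → c * (w₂ - w t) ≤ Φ (w t) := by
    intro t ht
    have h1 : w 0 ≤ w t := hmono.monotone ht
    have h2 := hlt t
    have := hΦ.2 (Set.mem_univ (w 0)) (Set.mem_univ w₂)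
      (show 0 ≤ (w₂ - w t) / (w₂ - w 0) from div_nonneg (by linarith) h0.le)
      (show 0 ≤ (w t - w 0) / (w₂ - w 0) from div_nonneg (by linarith) h0.le)
      (by rw [← add_div, div_eq_one_iff_eq h0.ne']; ring)
    have e : (w₂ - w t) / (w₂ - w 0) * w 0 + (w t - w 0) / (w₂ - w 0) * w₂ = w t := by
      field_simp; ring
    simp only [smul_eq_mul, h₂, mul_zero, add_zero] at this
    rw [e] at this
    calc c * (w₂ - w t) = (w₂ - w t) / (w₂ - w 0) * Φ (w 0) := by rw [hc]; ring
      _ ≤ _ := this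
  refine ⟨k * c, by positivity, fun t ht => ?_⟩
  have hder : ∀ t, HasDerivAt (fun t => (w₂ - w t) * Real.exp (k * c * t))
      (-(k * Φ (w t)) * Real.exp (k * c * t) + (w₂ - w t) * (Real.exp (k * c * t) * (k * c))) t :=
    fun t => ((hw t).const_sub w₂).mul (by simpa using ((hasDerivAt_id t).const_mul (k * c)).exp)
  have hanti : AntitoneOn (fun t => (w₂ - w t) * Real.exp (k * c * t)) (Set.Ici 0) := by
    refine antitoneOn_of_deriv_nonpos (convex_Ici 0)
      (fun t _ => (hder t).continuousAt.continuousWithinAt)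
      (fun t _ => (hder t).differentiableAt.differentiableWithinAt) ?_
    intro t ht
    rw [interior_Ici] at ht
    rw [(hder t).deriv]
    have := hlow t (le_of_lt ht)
    have he := Real.exp_pos (k * c * t)
    have : k * (c * (w₂ - w t)) * Real.exp (k * c * t) ≤ k * Φ (w t) * Real.exp (k * c * t) := by
      gcongr
    nlinarith
  have := hanti (Set.mem_Ici.2 le_rfl) ht ht
  simp only [mul_zero, Real.exp_zero, mul_one] at this
  rw [Real.exp_neg, ← div_eq_mul_inv, le_div_iff₀ (Real.exp_pos _)]
  exact this

/-- A function whose derivative decays exponentially has a limit at infinity. -/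
lemma tendsto_of_exp_deriv {D D' : ℝ → ℝ} {C κ T : ℝ} (hκ : 0 < κ)
    (hD : ∀ t, HasDerivAt D (D' t) t) (hb : ∀ t, T ≤ t → |D' t| ≤ C * Real.exp (-(κ * t))) :
    ∃ L, Tendsto D atTop (𝓝 L) := by
  have hint : IntegrableOn (fun t => C * Real.exp (-(κ * t))) (Set.Ioi T) := by
    simpa [IntegrableOn] using (integrableOn_exp_mul_Ioi (neg_neg_iff_pos.2 hκ) T).const_mul C
  have hm : IntegrableOn D' (Set.Ioi T) := by
    refine Integrable.mono' hint ?_ ?_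
    · rw [show D' = deriv D from funext fun t => ((hD t).deriv).symm]
      exact (measurable_deriv D).aestronglyMeasurable
    · filter_upwards [ae_restrict_mem measurableSet_Ioi] with t ht
      exact hb t (le_of_lt ht)
  exact ⟨_, tendsto_limUnder_of_hasDerivAt_of_integrableOn_Ioi (fun t _ => hD t) hm⟩

end HardySobolev

/-! ### The Hamiltonian system: zero energy, slope equation, limits and uniqueness. -/

namespace HardySobolev

/-- Nonnegative nontrivial orbits of the autonomous Hamiltonian system obtained from the radial
equation by the Emden-Fowler change of variables, which come arbitrarily close to the origin. -/
structure IsOrbit (p p' q δ m : ℝ) (y z : ℝ → ℝ) : Prop where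
  deriv_fst : ∀ t, HasDerivAt y (δ * y t - dpow p' (z t)) t
  deriv_snd : ∀ t, HasDerivAt z (-δ * z t + m * dpow p (y t) + dpow q (y t)) t
  nonneg : ∀ t, 0 ≤ y t
  exists_pos : ∃ t, 0 < y t
  exists_small : ∀ ε > 0, ∃ t, |y t| < ε ∧ |z t| < ε

namespace IsOrbit

variable {p p' q δ m : ℝ} {y z : ℝ → ℝ}

/-- Reversing time, with a change of sign of `z` and `δ`, preserves the system; behaviour at `-∞`
thus follows from behaviour at `+∞`. This is why `δ` is not assumed positive for orbits. -/
lemma reflect (ho : IsOrbit p p' q δ m y z) :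
    IsOrbit p p' q (-δ) m (fun t => y (-t)) (fun t => -z (-t)) where
  deriv_fst t := by
    have := (ho.deriv_fst (-t)).comp t (hasDerivAt_neg t)
    refine HasDerivAt.congr_deriv this ?_
    rw [dpow_neg]; ring
  deriv_snd t := by
    have := ((ho.deriv_snd (-t)).comp t (hasDerivAt_neg t)).neg
    refine HasDerivAt.congr_deriv this ?_
    ring
  nonneg t := ho.nonneg _
  exists_pos := by
    obtain ⟨t, ht⟩ := ho.exists_pos
    exact ⟨-t, by simpa⟩
  exists_small ε hε := by
    obtain ⟨t, ht⟩ := ho.exists_small ε hε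
    exact ⟨-t, by simpa⟩

/-- The left side is the Hamiltonian, constant along the orbit. It is continuous and vanishes at the
origin, to which the orbit comes arbitrarily close. -/
lemma energy_eq_zero (h : p.HolderConjugate p') (hq : 1 < q) (ho : IsOrbit p p' q δ m y z)
    (t : ℝ) :
    δ * y t * z t - |z t| ^ p' / p' - m * (|y t| ^ p / p) - |y t| ^ q / q = 0 := by
  set H : ℝ → ℝ → ℝ := fun a b =>
    δ * a * b - |b| ^ p' / p' - m * (|a| ^ p / p) - |a| ^ q / q with hH
  have hder : ∀ t, HasDerivAt (fun t => H (y t) (z t)) 0 t := by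
    intro t
    have hy := ho.deriv_fst t
    have hz := ho.deriv_snd t
    have h1 := (hy.const_mul δ).mul hz
    have h2 := (hasDerivAt_abs_rpow_div h.symm.lt (z t)).comp t hz
    have h3 := ((hasDerivAt_abs_rpow_div h.lt (y t)).comp t hy).const_mul m
    have h4 := (hasDerivAt_abs_rpow_div hq (y t)).comp t hy
    refine HasDerivAt.congr_deriv (((h1.sub h2).sub h3).sub h4) ?_
    ring
  have hconst : ∀ s, H (y t) (z t) = H (y s) (z s) := fun s =>
    is_const_of_deriv_eq_zero (fun r => (hder r).differentiableAt) (fun r => (hder r).deriv) t s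
  have hcont : Continuous fun x : ℝ × ℝ => H x.1 x.2 := by
    have c1 : ∀ {a : ℝ}, 1 < a → Continuous fun x : ℝ => |x| ^ a / a := fun ha =>
      continuous_iff_continuousAt.2 fun x => (hasDerivAt_abs_rpow_div ha x).continuousAt
    exact ((((continuous_const.mul continuous_fst).mul continuous_snd).sub
      ((c1 h.symm.lt).comp continuous_snd)).sub
      (continuous_const.mul ((c1 h.lt).comp continuous_fst))).sub ((c1 hq).comp continuous_fst)
  by_contra hne
  change H (y t) (z t) ≠ 0 at hne
  have h00 : H 0 0 = 0 := by
    simp [hH, Real.zero_rpow h.ne_zero, Real.zero_rpow h.symm.ne_zero,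
      Real.zero_rpow (show q ≠ 0 by linarith)]
  have := Metric.continuousAt_iff.1 (hcont.continuousAt (x := ((0 : ℝ), (0 : ℝ)))) _
    (abs_pos.2 hne)
  obtain ⟨ε, hε, hb⟩ := this
  obtain ⟨s, hs1, hs2⟩ := ho.exists_small ε hε
  have := hb (x := (y s, z s)) (by
    rw [Prod.dist_eq, max_lt_iff]; simpa [Real.dist_eq] using ⟨hs1, hs2⟩)
  simp only [h00, Real.dist_eq, sub_zero] at this
  rw [hconst s] at this
  exact lt_irrefl _ this

/-- After `z = y^(p-1) w` every term of the zero energy identity except the last is homogeneous of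
degree `p` in `y`; divide by `y^p`. -/
lemma phi_slope (h : p.HolderConjugate p') (hq : p < q) (ho : IsOrbit p p' q δ m y z)
    {t : ℝ} (ht : 0 < y t) :
    phi p' δ (m / p) (z t / y t ^ (p - 1)) = y t ^ (q - p) / q := by
  have hp := h.lt
  have hE := ho.energy_eq_zero h (hp.trans hq) t
  set w := z t / y t ^ (p - 1) with hw
  have hz : z t = y t ^ (p - 1) * w := by rw [hw]; field_simp
  have e1 : y t * y t ^ (p - 1) = y t ^ p := by
    rw [← Real.rpow_one_add' ht.le (by linarith)]; congr 1; ring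
  have e2 : (y t ^ (p - 1)) ^ p' = y t ^ p := by
    rw [← Real.rpow_mul ht.le]; congr 1
    have := h.mul_eq_add
    linarith
  have e3 : y t ^ q = y t ^ p * y t ^ (q - p) := by
    rw [← Real.rpow_add ht]; congr 1; ring
  rw [hz, abs_mul, Real.mul_rpow (abs_nonneg _) (abs_nonneg _), abs_of_pos ht,
    abs_of_pos (Real.rpow_pos_of_pos ht (p - 1)), e2, e3,
    show δ * y t * (y t ^ (p - 1) * w) = δ * w * (y t * y t ^ (p - 1)) by ring, e1] at hE
  have hyp : 0 < y t ^ p := Real.rpow_pos_of_pos ht p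
  have : y t ^ p * (phi p' δ (m / p) w - y t ^ (q - p) / q) = 0 := by
    rw [← hE, phi]; ring
  have := (mul_eq_zero.1 this).resolve_left hyp.ne'
  linarith

lemma dpow_slope (h : p.HolderConjugate p') {a b : ℝ} (ha : 0 < a) :
    dpow p' b = a * dpow p' (b / a ^ (p - 1)) := by
  have : b = a ^ (p - 1) * (b / a ^ (p - 1)) := by
    have := (Real.rpow_pos_of_pos ha (p - 1)).ne'
    field_simp
  conv_lhs => rw [this]
  rw [dpow_mul (Real.rpow_pos_of_pos ha _), ← Real.rpow_mul ha.le, conj_sub_one_mul h,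
    Real.rpow_one]

/-- The slope is confined between the zeros of `phi`, so `|y'| ≤ M y`. Then `y e^{Mt}` increases and
`y e^{-Mt}` decreases, and positivity spreads from one time to all times. -/
lemma pos (h : p.HolderConjugate p') (hq : p < q) (ho : IsOrbit p p' q δ m y z)
    (hpos : 0 < phi p' δ (m / p) (dpow p δ)) (t : ℝ) : 0 < y t := by
  obtain ⟨w₁, w₂, -, -, -, -, hiff⟩ := exists_phi_zeros h hpos
  have hp := h.lt
  set M := |δ| + max |dpow p' w₁| |dpow p' w₂| with hM
  have hbound : ∀ t, |δ * y t - dpow p' (z t)| ≤ M * y t := by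
    intro t
    -- Where `y` vanishes the slope is undefined, but zero energy forces `z` to vanish too.
    rcases (ho.nonneg t).eq_or_lt with h0 | h0
    · have hE := ho.energy_eq_zero h (hp.trans hq) t
      rw [← h0, abs_zero, Real.zero_rpow h.ne_zero,
        Real.zero_rpow (show q ≠ 0 by linarith)] at hE
      have : |z t| ^ p' = 0 := by
        have h1 : |z t| ^ p' / p' = 0 := by simpa using hE
        exact (div_eq_zero_iff.1 h1).resolve_right h.symm.ne_zero
      have hz : z t = 0 := abs_eq_zero.1 ((Real.rpow_eq_zero (abs_nonneg _) h.symm.ne_zero).1 this)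
      simp [← h0, hz]
    · have hw := (hiff (z t / y t ^ (p - 1))).1 (by
        rw [ho.phi_slope h hq h0]
        exact div_nonneg (Real.rpow_nonneg h0.le _) (by linarith))
      have hm := (strictMono_dpow h.symm.lt).monotone
      have := abs_le_max_abs_abs (hm hw.1) (hm hw.2)
      rw [dpow_slope h h0 (b := z t), mul_comm δ, ← mul_sub, abs_mul, abs_of_pos h0, mul_comm]
      gcongr
      exact (abs_sub _ _).trans (by rw [hM]; gcongr)
  obtain ⟨t₀, ht₀⟩ := ho.exists_pos
  have hd : ∀ (c t : ℝ), HasDerivAt (fun t => y t * Real.exp (c * t))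
      ((δ * y t - dpow p' (z t) + c * y t) * Real.exp (c * t)) t := fun c t => by
    have := (ho.deriv_fst t).mul (by simpa using ((hasDerivAt_id t).const_mul c).exp)
    refine HasDerivAt.congr_deriv this ?_
    ring
  rcases le_total t₀ t with htt | htt
  · have hmono : Monotone fun t => y t * Real.exp (M * t) :=
      monotone_of_deriv_nonneg (fun t => (hd M t).differentiableAt) fun t => by
        rw [(hd M t).deriv]
        have := (abs_le.1 (hbound t)).1
        exact mul_nonneg (by linarith) (Real.exp_pos _).le
    have := (mul_pos ht₀ (Real.exp_pos _)).trans_le (hmono htt)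
    exact pos_of_mul_pos_left this (Real.exp_pos _).le
  · have hanti : Antitone fun t => y t * Real.exp (-M * t) :=
      antitone_of_deriv_nonpos (fun t => (hd (-M) t).differentiableAt) fun t => by
        rw [(hd (-M) t).deriv]
        have := (abs_le.1 (hbound t)).2
        exact mul_nonpos_of_nonpos_of_nonneg (by linarith) (Real.exp_pos _).le
    have := (mul_pos ht₀ (Real.exp_pos _)).trans_le (hanti htt)
    exact pos_of_mul_pos_left this (Real.exp_pos _).le

/-- The quotient rule gives `w' = -(pδw - (p-1)|w|^p' - m) + y^(q-p)`. As `p / p' = p - 1`, the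
bracket is `p * phi`, while zero energy turns the last term into `q * phi`. -/
lemma hasDerivAt_slope (h : p.HolderConjugate p') (hq : p < q) (ho : IsOrbit p p' q δ m y z)
    {t : ℝ} (ht : 0 < y t) :
    HasDerivAt (fun t => z t / y t ^ (p - 1))
      ((q - p) * phi p' δ (m / p) (z t / y t ^ (p - 1))) t := by
  have hp := h.lt
  have hY : 0 < y t ^ (p - 1) := Real.rpow_pos_of_pos ht _
  have h1 := (ho.deriv_snd t).div ((ho.deriv_fst t).rpow_const (p := p - 1) (Or.inl ht.ne'))
    hY.ne'
  refine HasDerivAt.congr_deriv h1 ?_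
  have hs := ho.phi_slope h hq ht
  set w := z t / y t ^ (p - 1) with hw
  have hz : z t = y t ^ (p - 1) * w := by rw [hw]; field_simp
  have e1 : dpow p' (z t) = y t * dpow p' w := dpow_slope h ht
  have e2 : y t ^ (p - 1) = y t ^ (p - 1 - 1) * y t := by
    rw [← Real.rpow_add_one ht.ne']; congr 1; ring
  have e3 : y t ^ (q - 1) = y t ^ (q - p) * y t ^ (p - 1) := by
    rw [← Real.rpow_add ht]; congr 1; ring
  have e4 : y t ^ (q - p) = q * phi p' δ (m / p) w := by
    rw [hs]; field_simp [(show q ≠ 0 by linarith)]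
  have e5 : p * phi p' δ (m / p) w = p * δ * w - (p - 1) * (w * dpow p' w) - m := by
    rw [phi, ← mul_dpow h.symm.lt]
    have h1 : p ≠ 0 := h.ne_zero
    have h2 : p' ≠ 0 := h.symm.ne_zero
    have h3 : p / p' = p - 1 := by rw [h.div_conj_eq_sub_one]
    have : p * (w * dpow p' w / p') = p / p' * (w * dpow p' w) := by ring
    rw [mul_sub, mul_sub, this, h3]; field_simp
  rw [dpow_of_pos ht, dpow_of_pos ht, e1, hz, e3, e4]
  have hY' : y t ^ (p - 1 - 1) * y t ≠ 0 := by rw [← e2]; exact hY.ne'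
  have : (δ * y t - y t * dpow p' w) * (p - 1) * y t ^ (p - 1 - 1)
      = (δ - dpow p' w) * (p - 1) * y t ^ (p - 1) := by rw [e2]; ring
  rw [this]
  field_simp
  linear_combination e5

/-- The logarithmic derivative of `y` is `δ - dpow p' w`. Exponential convergence of `w`, with
Hölder continuity of `dpow p'` at `w₂`, makes its deviation from the limit integrable, so `log y`
minus a linear function converges. -/
lemma tendsto_atTop (h : p.HolderConjugate p') (hq : p < q) (ho : IsOrbit p p' q δ m y z)
    (hpos : ∀ t, 0 < y t) {w₂ : ℝ} (h₂ : phi p' δ (m / p) w₂ = 0)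
    (hlt : ∀ t, z t / y t ^ (p - 1) < w₂) :
    Tendsto (fun t => z t / y t ^ (p - 1)) atTop (𝓝 w₂) ∧
    Tendsto (fun t => dpow p' (z t) / y t) atTop (𝓝 (dpow p' w₂)) ∧
    ∃ C, 0 < C ∧ Tendsto (fun t => y t * Real.exp ((dpow p' w₂ - δ) * t)) atTop (𝓝 C) := by
  have hp := h.lt
  set w := fun t => z t / y t ^ (p - 1) with hw
  have hwd : ∀ t, HasDerivAt w ((q - p) * phi p' δ (m / p) (w t)) t :=
    fun t => ho.hasDerivAt_slope h hq (hpos t)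
  have hphi : ∀ t, 0 < phi p' δ (m / p) (w t) := fun t => by
    have := ho.phi_slope h hq (hpos t)
    rw [hw]; simp only; rw [this]
    exact div_pos (Real.rpow_pos_of_pos (hpos t) _) (by linarith)
  obtain ⟨κ, hκ, hexp⟩ := exp_approach (sub_pos.2 hq) (concaveOn_phi h.symm.lt δ (m / p)) h₂ hwd
    hlt hphi
  have hlim0 : Tendsto (fun t => (w₂ - w 0) * Real.exp (-(κ * t))) atTop (𝓝 0) := by
    have : Tendsto (fun t => Real.exp (-(κ * t))) atTop (𝓝 0) :=
      Real.tendsto_exp_neg_atTop_nhds_zero.comp (tendsto_id.const_mul_atTop hκ)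
    simpa using this.const_mul (w₂ - w 0)
  have hwlim : Tendsto w atTop (𝓝 w₂) := by
    have : Tendsto (fun t => w₂ - w t) atTop (𝓝 0) :=
      squeeze_zero' (Eventually.of_forall fun t => (sub_pos.2 (hlt t)).le)
        ((eventually_ge_atTop 0).mono hexp) hlim0
    simpa using this.const_sub w₂
  have hslope : ∀ t, dpow p' (z t) / y t = dpow p' (w t) := fun t => by
    rw [dpow_slope h (hpos t), mul_div_cancel_left₀ _ (hpos t).ne']
  refine ⟨hwlim, ?_, ?_⟩
  · simp_rw [hslope]
    exact ((continuous_dpow h.symm.lt).tendsto w₂).comp hwlim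
  obtain ⟨C, β, ε, hC, hβ, hε, hholder⟩ := exists_abs_dpow_sub_le h.symm.lt (w₁ := w₂)
  obtain ⟨T, hT⟩ := eventually_atTop.1 (((Metric.tendsto_nhds.1 hwlim) ε hε).and
    (eventually_ge_atTop 0))
  have hD : ∀ t, HasDerivAt (fun t => Real.log (y t) + (dpow p' w₂ - δ) * t)
      (dpow p' w₂ - dpow p' (w t)) t := fun t => by
    have := ((ho.deriv_fst t).log (hpos t).ne').add
      ((hasDerivAt_id t).const_mul (dpow p' w₂ - δ))
    refine HasDerivAt.congr_deriv this ?_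
    rw [sub_div, hslope, mul_div_cancel_right₀ _ (hpos t).ne']
    ring
  obtain ⟨L, hL⟩ := tendsto_of_exp_deriv (C := C * (w₂ - w 0) ^ β) (κ := κ * β) (T := T)
    (by positivity) hD (fun t ht => by
      obtain ⟨h1, h2⟩ := hT t ht
      rw [Real.dist_eq] at h1
      rw [abs_sub_comm]
      refine (hholder _ h1).trans ?_
      have h3 : |w t - w₂| ≤ (w₂ - w 0) * Real.exp (-(κ * t)) := by
        rw [abs_sub_comm, abs_of_pos (sub_pos.2 (hlt t))]
        exact hexp t h2
      have h4 : (0 : ℝ) ≤ w₂ - w 0 := (sub_pos.2 (hlt 0)).le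
      calc C * |w t - w₂| ^ β ≤ C * ((w₂ - w 0) * Real.exp (-(κ * t))) ^ β := by gcongr
        _ = _ := by
          rw [Real.mul_rpow h4 (Real.exp_pos _).le, ← Real.exp_mul, mul_assoc]
          congr 3; ring)
  refine ⟨Real.exp L, Real.exp_pos L, ?_⟩
  refine ((Real.continuous_exp.tendsto L).comp hL).congr fun t => ?_
  rw [Function.comp_apply, Real.exp_add, Real.exp_log (hpos t)]

/-- The slope stays between the zeros of `Φ`. -/
lemma slope_mem (h : p.HolderConjugate p') (hq : p < q) (ho : IsOrbit p p' q δ m y z)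
    {w₁ w₂ : ℝ} (h₁ : phi p' δ (m / p) w₁ = 0) (h₂ : phi p' δ (m / p) w₂ = 0)
    (hiff : ∀ w, 0 ≤ phi p' δ (m / p) w ↔ w ∈ Set.Icc w₁ w₂) {t : ℝ} (ht : 0 < y t) :
    z t / y t ^ (p - 1) ∈ Set.Ioo w₁ w₂ := by
  have hp := h.lt
  have hphi : 0 < phi p' δ (m / p) (z t / y t ^ (p - 1)) := by
    rw [ho.phi_slope h hq ht]
    exact div_pos (Real.rpow_pos_of_pos ht _) (by linarith)
  have := (hiff _).1 hphi.le
  exact ⟨lt_of_le_of_ne this.1 (by rintro h; rw [← h, h₁] at hphi; exact lt_irrefl _ hphi),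
    lt_of_le_of_ne this.2 (by rintro h; rw [h, h₂] at hphi; exact lt_irrefl _ hphi)⟩

lemma tendsto_atBot (h : p.HolderConjugate p') (hq : p < q) (ho : IsOrbit p p' q δ m y z)
    (hpos : ∀ t, 0 < y t) {w₁ : ℝ} (h₁ : phi p' δ (m / p) w₁ = 0)
    (hlt : ∀ t, w₁ < z t / y t ^ (p - 1)) :
    Tendsto (fun t => z t / y t ^ (p - 1)) atBot (𝓝 w₁) ∧
    Tendsto (fun t => dpow p' (z t) / y t) atBot (𝓝 (dpow p' w₁)) ∧
    ∃ C, 0 < C ∧ Tendsto (fun t => y t * Real.exp ((dpow p' w₁ - δ) * t)) atBot (𝓝 C) := by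
  obtain ⟨a, b, C, hC, c⟩ := ho.reflect.tendsto_atTop h hq (fun t => hpos (-t)) (w₂ := -w₁)
    (by rw [phi_neg_arg, neg_neg, h₁]) (fun t => by
      rw [neg_div]; exact neg_lt_neg (hlt _))
  refine ⟨?_, ?_, C, hC, ?_⟩
  · have := (a.comp tendsto_neg_atBot_atTop).neg
    refine (this.congr fun t => ?_).mono_right (by rw [neg_neg])
    simp [neg_div]
  · have := (b.comp tendsto_neg_atBot_atTop).neg
    refine (this.congr fun t => ?_).mono_right (by rw [dpow_neg, neg_neg])
    simp [dpow_neg, neg_div]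
  · refine (c.comp tendsto_neg_atBot_atTop).congr fun t => ?_
    simp only [Function.comp_apply, neg_neg, dpow_neg]
    congr 2; ring

/-- Each slope takes every value between `w₁` and `w₂`, so after a translation the two slopes agree
at one time, hence always by uniqueness for the scalar equation. The relation `phi w = y^(q-p) / q`
then returns `y`. -/
lemma eq_translate {y₁ z₁ y₂ z₂ : ℝ → ℝ} (h : p.HolderConjugate p') (hq : p < q)
    (hδ : 0 < phi p' δ (m / p) (dpow p δ)) (ho₁ : IsOrbit p p' q δ m y₁ z₁)
    (ho₂ : IsOrbit p p' q δ m y₂ z₂) : ∃ T, ∀ t, y₂ t = y₁ (t + T) := by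
  have hp := h.lt
  obtain ⟨w₁, w₂, hl₁, hl₂, h₁, h₂, hiff⟩ := exists_phi_zeros h hδ
  have p₁ := ho₁.pos h hq hδ
  have p₂ := ho₂.pos h hq hδ
  have m₁ := fun t => ho₁.slope_mem h hq h₁ h₂ hiff (p₁ t)
  have m₂ := fun t => ho₂.slope_mem h hq h₁ h₂ hiff (p₂ t)
  set W₁ := fun t => z₁ t / y₁ t ^ (p - 1) with hW₁
  set W₂ := fun t => z₂ t / y₂ t ^ (p - 1) with hW₂
  have d₁ : ∀ t, HasDerivAt W₁ ((q - p) * phi p' δ (m / p) (W₁ t)) t :=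
    fun t => ho₁.hasDerivAt_slope h hq (p₁ t)
  have d₂ : ∀ t, HasDerivAt W₂ ((q - p) * phi p' δ (m / p) (W₂ t)) t :=
    fun t => ho₂.hasDerivAt_slope h hq (p₂ t)
  obtain ⟨T, hT⟩ : ∃ T, W₁ T = W₂ 0 := by
    have c : Continuous W₁ := continuous_iff_continuousAt.2 fun t => (d₁ t).continuousAt
    have l1 := (ho₁.tendsto_atTop h hq p₁ h₂ fun t => (m₁ t).2).1
    have l2 := (ho₁.tendsto_atBot h hq p₁ h₁ fun t => (m₁ t).1).1
    obtain ⟨a, ha⟩ := (l2.eventually_lt_const (m₂ 0).1).exists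
    obtain ⟨b, hb⟩ := (l1.eventually_const_lt (m₂ 0).2).exists
    exact mem_range_of_exists_le_of_exists_ge c ⟨a, ha.le⟩ ⟨b, hb.le⟩
  -- `phi` is continuously differentiable, hence Lipschitz on the compact interval containing both
  -- slopes. The original system need not be Lipschitz at zeros of `y` or `z`.
  obtain ⟨K, hK⟩ : ∃ K, LipschitzOnWith K (fun w => (q - p) * phi p' δ (m / p) w)
      (Set.Icc w₁ w₂) := by
    have hc : Continuous fun w => (q - p) * (δ - dpow p' w) :=
      continuous_const.mul (continuous_const.sub (continuous_dpow h.symm.lt))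
    obtain ⟨K, hK⟩ := (isCompact_Icc (a := w₁) (b := w₂)).exists_bound_of_continuousOn
      hc.continuousOn
    refine ⟨K.toNNReal, (convex_Icc w₁ w₂).lipschitzOnWith_of_nnnorm_hasDerivWithin_le
      (f' := fun w => (q - p) * (δ - dpow p' w))
      (fun w _ => ((hasDerivAt_phi h.symm.lt δ (m / p) w).const_mul _).hasDerivWithinAt)
      fun w hw => ?_⟩
    rw [← NNReal.coe_le_coe, coe_nnnorm]
    exact (hK w hw).trans (Real.le_coe_toNNReal K)
  have hEq : W₂ = fun t => W₁ (t + T) := by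
    refine ODE_solution_unique_univ (v := fun _ w => (q - p) * phi p' δ (m / p) w)
      (s := fun _ => Set.Icc w₁ w₂) (t₀ := 0) (K := K) (fun _ => hK)
      (fun t => ⟨d₂ t, Set.Ioo_subset_Icc_self (m₂ t)⟩)
      (fun t => ⟨(d₁ (t + T)).comp_add_const t T, Set.Ioo_subset_Icc_self (m₁ _)⟩) ?_
    simp [hT]
  refine ⟨T, fun t => ?_⟩
  have e₁ := ho₁.phi_slope h hq (p₁ (t + T))
  have e₂ := ho₂.phi_slope h hq (p₂ t)
  have : W₂ t = W₁ (t + T) := congrFun hEq t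
  simp only [hW₁, hW₂] at this
  rw [← this, e₂, div_left_inj' (by linarith)] at e₁
  exact (Real.rpow_left_inj (p₂ t).le (p₁ _).le (by linarith)).1 e₁

end IsOrbit

end HardySobolev

/-! ### Radial profiles and the Emden-Fowler change of variables. -/

namespace HardySobolev

/-- Radial profiles of the positive radial solutions, with their derivatives. -/
structure IsProfile (N : ℕ) (p μ s : ℝ) (F D : ℝ → ℝ) : Prop where
  nonneg : ∀ r, 0 < r → 0 ≤ F r
  exists_pos : ∃ r, 0 < r ∧ 0 < F r
  hasDerivAt : ∀ r, 0 < r → HasDerivAt F (D r) r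
  flux : ∀ r, 0 < r → HasDerivAt (fun r => r ^ (N - 1) * dpow p (D r))
    (-(r ^ (N - 1) * (μ / r ^ p * dpow p (F r) + dpow (critExp N p s) (F r) / r ^ s))) r
  energy : IntegrableOn (fun r => r ^ (N - 1) * |D r| ^ p) (Set.Ioi 0)
  mass : IntegrableOn (fun r => r ^ (N - 1) * |F r| ^ critExp N p 0) (Set.Ioi 0)

/-- The first Emden-Fowler variable. -/
noncomputable def emdenFst (N : ℕ) (p : ℝ) (F : ℝ → ℝ) (t : ℝ) : ℝ :=
  Real.exp (((N : ℝ) - p) / p * t) * F (Real.exp t)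

/-- The second Emden-Fowler variable. -/
noncomputable def emdenSnd (N : ℕ) (p : ℝ) (D : ℝ → ℝ) (t : ℝ) : ℝ :=
  -(Real.exp (-(((N : ℝ) - p) / p) * t) * (Real.exp t ^ (N - 1) * dpow p (D (Real.exp t))))

section Emden

variable {N : ℕ} {p p' μ s : ℝ} {F D : ℝ → ℝ}

lemma exp_pow_pred (hp : 1 < p) (hpN : p < (N : ℝ)) (t : ℝ) :
    Real.exp t ^ (N - 1) = Real.exp (((N : ℝ) - 1) * t) := by
  have hN : 1 ≤ N := by
    have : (1 : ℝ) < N := hp.trans hpN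
    exact_mod_cast this.le
  rw [← Real.exp_nat_mul, Nat.cast_sub hN, Nat.cast_one]

lemma emdenSnd_eq (hp : 1 < p) (hpN : p < (N : ℝ)) (t : ℝ) :
    emdenSnd N p D t = -(Real.exp ((N : ℝ) / p * t) ^ (p - 1) * dpow p (D (Real.exp t))) := by
  rw [emdenSnd, exp_pow_pred hp hpN, ← mul_assoc, ← Real.exp_add, ← Real.exp_mul]
  congr 3
  have : p ≠ 0 := by linarith
  field_simp; ring

lemma dpow_emdenSnd (h : p.HolderConjugate p') (hpN : p < (N : ℝ)) (t : ℝ) :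
    dpow p' (emdenSnd N p D t) = -(Real.exp ((N : ℝ) / p * t) * D (Real.exp t)) := by
  rw [emdenSnd_eq h.lt hpN, dpow_neg, dpow_mul (by positivity), dpow_dpow h,
    ← Real.rpow_mul (Real.exp_pos _).le, conj_sub_one_mul h, Real.rpow_one]

lemma critExp_gt (hp : 1 < p) (hpN : p < (N : ℝ)) (hsp : s < p) : p < critExp N p s := by
  rw [critExp, lt_div_iff₀ (by linarith)]
  nlinarith

/-- The powers of `r = e^t` cancel in both source terms because of the Hardy weight `r^{-p}` and the
identity `δ * critExp N p s = N - s`; the resulting system is autonomous. -/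
lemma IsProfile.isOrbit (h : p.HolderConjugate p') (hpN : p < (N : ℝ))
    (hP : IsProfile N p μ s F D) :
    IsOrbit p p' (critExp N p s) (((N : ℝ) - p) / p) μ (emdenFst N p F) (emdenSnd N p D) := by
  have hp := h.lt
  have hp0 : p ≠ 0 := h.ne_zero
  have hNp : (N : ℝ) - p ≠ 0 := by linarith
  have hexp : ∀ c t : ℝ, HasDerivAt (fun t => Real.exp (c * t)) (c * Real.exp (c * t)) t :=
    fun c t => by
      have := ((hasDerivAt_id t).const_mul c).exp
      exact this.congr_deriv (by simp [mul_comm])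
  refine ⟨fun t => ?_, fun t => ?_, fun t => ?_, ?_, ?_⟩
  · have := (hexp (((N : ℝ) - p) / p) t).mul
      ((hP.hasDerivAt _ (Real.exp_pos t)).comp t (Real.hasDerivAt_exp t))
    refine this.congr_deriv ?_
    rw [dpow_emdenSnd h hpN, emdenFst, Function.comp_apply]
    have : (N : ℝ) / p * t = ((N : ℝ) - p) / p * t + t := by field_simp; ring
    rw [this, Real.exp_add]; ring
  · have := ((hexp (-(((N : ℝ) - p) / p)) t).mul
      ((hP.flux _ (Real.exp_pos t)).comp t (Real.hasDerivAt_exp t))).neg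
    refine this.congr_deriv ?_
    rw [emdenSnd, emdenFst, dpow_mul (Real.exp_pos _), dpow_mul (Real.exp_pos _),
      Function.comp_apply, exp_pow_pred hp hpN, ← Real.exp_mul, ← Real.exp_mul, ← Real.exp_mul,
      ← Real.exp_mul]
    have e1 : Real.exp (((N : ℝ) - p) / p * t * (p - 1)) =
        Real.exp (-(((N : ℝ) - p) / p) * t) * Real.exp (((N : ℝ) - 1) * t) * Real.exp t /
          Real.exp (t * p) := by
      rw [← Real.exp_add, ← Real.exp_add, ← Real.exp_sub]
      congr 1; field_simp; ring
    have e2 : Real.exp (((N : ℝ) - p) / p * t * (critExp N p s - 1)) =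
        Real.exp (-(((N : ℝ) - p) / p) * t) * Real.exp (((N : ℝ) - 1) * t) * Real.exp t /
          Real.exp (t * s) := by
      rw [← Real.exp_add, ← Real.exp_add, ← Real.exp_sub, critExp]
      congr 1; field_simp; ring
    rw [e1, e2]
    ring
  · exact mul_nonneg (Real.exp_pos _).le (hP.nonneg _ (Real.exp_pos t))
  · obtain ⟨r, hr, hF⟩ := hP.exists_pos
    refine ⟨Real.log r, mul_pos (Real.exp_pos _) ?_⟩
    rwa [Real.exp_log hr]
  · intro ε hε
    -- If the orbit avoids an `ε`-box about the origin, then `|z|^p' + |y|^(p^*(0)) ≥ c` for all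
    -- `t`. In the variable `r` this bounds the sum of the gradient and mass densities below by `c /
    -- r`, which is not integrable.
    by_contra! hcon
    have hq : p < critExp N p 0 := critExp_gt hp hpN (by linarith)
    set c := min (ε ^ critExp N p 0) (ε ^ p') with hc
    have hcpos : 0 < c := lt_min (by positivity) (by positivity)
    have hle : ∀ r, 0 < r → c * r⁻¹ ≤
        r ^ (N - 1) * |D r| ^ p + r ^ (N - 1) * |F r| ^ critExp N p 0 := by
      intro r hr
      have hr' : Real.exp (Real.log r) = r := Real.exp_log hr
      have hN : ∀ t, Real.exp ((N : ℝ) / p * t) ^ p = Real.exp t ^ (N - 1) * Real.exp t := by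
        intro t
        rw [exp_pow_pred hp hpN, ← Real.exp_mul, ← Real.exp_add]
        congr 1; field_simp; ring
      have hy : |emdenFst N p F (Real.log r)| ^ critExp N p 0 =
          r ^ (N - 1) * |F r| ^ critExp N p 0 * r := by
        have e : Real.exp (((N : ℝ) - p) / p * Real.log r) ^ critExp N p 0 = r ^ (N - 1) * r := by
          rw [← hr', ← hN, ← Real.exp_mul, ← Real.exp_mul, critExp, hr']
          congr 1; field_simp; ring
        rw [emdenFst, hr', abs_mul, Real.mul_rpow (abs_nonneg _) (abs_nonneg _), Real.abs_exp, e]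
        ring
      have hz : |emdenSnd N p D (Real.log r)| ^ p' = r ^ (N - 1) * |D r| ^ p * r := by
        rw [← abs_dpow_rpow h.symm, dpow_emdenSnd h hpN, abs_neg, abs_mul, Real.abs_exp, hr',
          Real.mul_rpow (Real.exp_pos _).le (abs_nonneg _), hN, hr']
        ring
      have hmain : c ≤ |emdenSnd N p D (Real.log r)| ^ p' +
          |emdenFst N p F (Real.log r)| ^ critExp N p 0 := by
        by_cases hy' : |emdenFst N p F (Real.log r)| < ε
        · have := hcon _ hy'
          calc c ≤ ε ^ p' := min_le_right _ _
            _ ≤ |emdenSnd N p D (Real.log r)| ^ p' :=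
              Real.rpow_le_rpow hε.le this h.symm.nonneg
            _ ≤ _ := le_add_of_nonneg_right (by positivity)
        · calc c ≤ ε ^ critExp N p 0 := min_le_left _ _
            _ ≤ |emdenFst N p F (Real.log r)| ^ critExp N p 0 :=
              Real.rpow_le_rpow hε.le (not_lt.1 hy') (by linarith)
            _ ≤ _ := le_add_of_nonneg_left (by positivity)
      rw [hy, hz] at hmain
      rw [← div_eq_mul_inv, div_le_iff₀ hr]
      linarith
    have hint : IntegrableOn (fun r : ℝ => c * r⁻¹) (Set.Ioi 0) := by
      refine Integrable.mono' (hP.energy.add hP.mass) (by fun_prop) ?_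
      filter_upwards [ae_restrict_mem measurableSet_Ioi] with r hr
      have hr : 0 < r := hr
      rw [Real.norm_of_nonneg (by positivity)]
      exact hle r hr
    have := hint.const_mul c⁻¹
    refine not_integrableOn_Ioi_inv (a := 0) ?_
    refine (this.congr (Eventually.of_forall fun r => ?_))
    field_simp

/-- The flux is differentiable, hence continuous, and `D` is recovered from it by the inverse odd
power. -/
lemma IsProfile.continuousOn_deriv (h : p.HolderConjugate p') (hP : IsProfile N p μ s F D) :
    ContinuousOn D (Set.Ioi 0) := by
  have h1 : ContinuousOn (fun r : ℝ => r ^ (N - 1) * dpow p (D r)) (Set.Ioi 0) :=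
    fun r hr => (hP.flux r hr).continuousAt.continuousWithinAt
  have h2 : ContinuousOn (fun r : ℝ => r ^ (N - 1) * dpow p (D r) / r ^ (N - 1)) (Set.Ioi 0) :=
    h1.div (by fun_prop) fun r hr => (pow_pos hr _).ne'
  refine ((continuous_dpow h.symm.lt).comp_continuousOn h2).congr fun r hr => ?_
  have : (r : ℝ) ^ (N - 1) ≠ 0 := (pow_pos hr _).ne'
  rw [Function.comp_apply, mul_div_cancel_left₀ _ this, dpow_dpow h]

lemma hasGradientAt_norm {E : Type*} [NormedAddCommGroup E] [InnerProductSpace ℝ E]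
    [CompleteSpace E] {x : E} (hx : x ≠ 0) :
    HasGradientAt (fun x : E => ‖x‖) (‖x‖⁻¹ • x) x := by
  have h1 : HasStrictFDerivAt (fun x : E => ‖x‖ ^ 2) (2 • innerSL ℝ x) x :=
    hasStrictFDerivAt_norm_sq x
  have h2 := h1.hasFDerivAt.sqrt (by simpa using hx)
  rw [hasGradientAt_iff_hasFDerivAt]
  simp only [Real.sqrt_sq (norm_nonneg _)] at h2
  refine h2.congr_fderiv ?_
  ext y
  simp [InnerProductSpace.toDual_apply_apply]
  field_simp

lemma hasGradientAt_comp_norm {E : Type*} [NormedAddCommGroup E] [InnerProductSpace ℝ E]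
    [CompleteSpace E] {x : E} (hx : x ≠ 0) {F : ℝ → ℝ} {d : ℝ} (hF : HasDerivAt F d ‖x‖) :
    HasGradientAt (fun x : E => F ‖x‖) ((d / ‖x‖) • x) x := by
  have := hF.comp_hasFDerivAt x (hasGradientAt_norm hx).hasFDerivAt
  rw [hasGradientAt_iff_hasFDerivAt]
  refine this.congr_fderiv ?_
  ext y
  simp [InnerProductSpace.toDual_apply_apply]
  ring

lemma HasAsymptotics.congr {γ₁ γ₂ C₁ C₂ : ℝ} {u v : Space N → ℝ} (huv : ∀ᵐ x, v x = u x)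
    (h : HasAsymptotics γ₁ γ₂ C₁ C₂ u) : HasAsymptotics γ₁ γ₂ C₁ C₂ v := by
  obtain ⟨w, hw, hr⟩ := h
  refine ⟨w, ?_, hr⟩
  filter_upwards [hw, huv] with x h1 h2
  rw [h1, h2]

/-- With `t = log r`, `y e^{(γ-δ)t}` is `F r * r^γ`, and `dpow p' z / y` is `-r D / F`. The limit of
the latter is the exponent, so the gradient limits are products of the two limits already known. -/
lemma IsProfile.hasAsymptotics (h : p.HolderConjugate p') (hpN : p < (N : ℝ)) (hsp : s < p)
    (hP : IsProfile N p μ s F D) {w₁ w₂ : ℝ} (hpos : 0 < phi p' (((N : ℝ) - p) / p) (μ / p)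
      (dpow p (((N : ℝ) - p) / p)))
    (h₁ : phi p' (((N : ℝ) - p) / p) (μ / p) w₁ = 0)
    (h₂ : phi p' (((N : ℝ) - p) / p) (μ / p) w₂ = 0) (hw₂ : 0 < w₂)
    (hiff : ∀ w, 0 ≤ phi p' (((N : ℝ) - p) / p) (μ / p) w ↔ w ∈ Set.Icc w₁ w₂)
    {u : Space N → ℝ} (hu : ∀ᵐ x, u x = F ‖x‖) :
    ∃ C₁ C₂, 0 < C₁ ∧ 0 < C₂ ∧ HasAsymptotics (dpow p' w₁) (dpow p' w₂) C₁ C₂ u := by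
  have hp := h.lt
  have hq := critExp_gt hp hpN hsp
  have ho := hP.isOrbit h hpN
  have hy := ho.pos h hq hpos
  have hm := fun t => ho.slope_mem h hq h₁ h₂ hiff (hy t)
  obtain ⟨-, a₂, C₂, hC₂, b₂⟩ := ho.tendsto_atTop h hq hy h₂ fun t => (hm t).2
  obtain ⟨-, a₁, C₁, hC₁, b₁⟩ := ho.tendsto_atBot h hq hy h₁ fun t => (hm t).1
  have hval : ∀ γ r : ℝ, 0 < r → emdenFst N p F (Real.log r) *
      Real.exp ((γ - ((N : ℝ) - p) / p) * Real.log r) = F r * r ^ γ := by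
    intro γ r hr
    rw [emdenFst, Real.exp_log hr, Real.rpow_def_of_pos hr, mul_comm (Real.exp _), mul_assoc,
      ← Real.exp_add]
    congr 2; ring
  have hgrad : ∀ γ r : ℝ, 0 < r →
      |dpow p' (emdenSnd N p D (Real.log r)) / emdenFst N p F (Real.log r)| *
      (emdenFst N p F (Real.log r) * Real.exp ((γ - ((N : ℝ) - p) / p) * Real.log r)) =
        |D r| * r ^ (γ + 1) := by
    intro γ r hr
    rw [abs_div, abs_of_pos (hy _), ← mul_assoc, div_mul_cancel₀ _ (hy _).ne',
      dpow_emdenSnd h hpN, abs_neg, abs_mul, Real.abs_exp, Real.exp_log hr,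
      Real.rpow_def_of_pos hr, mul_comm (Real.exp _), mul_assoc, ← Real.exp_add]
    congr 2
    have : p ≠ 0 := h.ne_zero
    field_simp; ring
  have hgr : ∀ x : Space N, x ≠ 0 →
      gradient (fun x : Space N => F ‖x‖) x = (D ‖x‖ / ‖x‖) • x := fun x hx =>
    (hasGradientAt_comp_norm hx (hP.hasDerivAt _ (norm_pos_iff.2 hx))).gradient
  have hgrn : ∀ x : Space N, x ≠ 0 → ‖gradient (fun x : Space N => F ‖x‖) x‖ = |D ‖x‖| := by
    intro x hx
    rw [hgr x hx, norm_smul, Real.norm_eq_abs, abs_div, abs_norm,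
      div_mul_cancel₀ _ (norm_pos_iff.2 hx).ne']
  have l0 : Tendsto (fun x : Space N => Real.log ‖x‖) (𝓝[≠] 0) atBot :=
    Real.tendsto_log_nhdsGT_zero.comp (tendsto_norm_nhdsNE_zero)
  have l1 : Tendsto (fun x : Space N => Real.log ‖x‖) (Bornology.cobounded (Space N)) atTop :=
    Real.tendsto_log_atTop.comp tendsto_norm_cobounded_atTop
  have n0 : ∀ᶠ x : Space N in 𝓝[≠] 0, x ≠ 0 := eventually_mem_nhdsWithin
  have n1 : ∀ᶠ x : Space N in Bornology.cobounded (Space N), x ≠ 0 :=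
    ((tendsto_norm_cobounded_atTop (E := Space N)).eventually_gt_atTop 0).mono
      fun x hx => norm_pos_iff.1 hx
  refine ⟨C₁, C₂, hC₁, hC₂, fun x => F ‖x‖, hu.mono fun x hx => hx.symm, ?_, ?_, ?_, ?_, ?_⟩
  · have hF1 : ContDiffOn ℝ 1 F (Set.Ioi 0) := by
      rw [show (1 : WithTop ℕ∞) = 0 + 1 from rfl, contDiffOn_succ_iff_deriv_of_isOpen isOpen_Ioi]
      refine ⟨fun r hr => (hP.hasDerivAt r hr).differentiableAt.differentiableWithinAt,
        by simp, ?_⟩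
      rw [contDiffOn_zero]
      exact (hP.continuousOn_deriv h).congr fun r hr => (hP.hasDerivAt r hr).deriv
    exact hF1.comp (fun x hx => (contDiffAt_norm ℝ hx).contDiffWithinAt)
      fun x hx => norm_pos_iff.2 hx
  · refine (b₁.comp l0).congr' ?_
    filter_upwards [n0] with x hx using hval _ _ (norm_pos_iff.2 hx)
  · refine (b₂.comp l1).congr' ?_
    filter_upwards [n1] with x hx using hval _ _ (norm_pos_iff.2 hx)
  · refine ((a₁.abs.comp l0).mul (b₁.comp l0)).congr' ?_
    filter_upwards [n0] with x hx
    rw [hgrn x hx]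
    exact hgrad _ _ (norm_pos_iff.2 hx)
  -- The exponent at infinity is positive, so it needs no absolute value, unlike the one at the
  -- origin.
  · rw [← abs_of_pos (dpow_pos (a := p') hw₂)]
    refine ((a₂.abs.comp l1).mul (b₂.comp l1)).congr' ?_
    filter_upwards [n1] with x hx
    rw [hgrn x hx]
    simp only [abs_of_pos (dpow_pos (a := p') hw₂)]
    exact hgrad _ _ (norm_pos_iff.2 hx)

lemma ae_smul_of_ae {P : Space N → Prop} (hP : ∀ᵐ x, P x) {τ : ℝ} (hτ : 0 < τ) :
    ∀ᵐ x, P (τ • x) := by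
  rw [ae_iff] at hP ⊢
  have : {x : Space N | ¬P (τ • x)} = (fun x => τ • x) ⁻¹' {x | ¬P x} := rfl
  rw [this, Measure.addHaar_preimage_smul _ hτ.ne', hP, mul_zero]

/-- Translation of `t` by `T` is dilation of `r` by `τ = e^T`. -/
lemma IsProfile.eq_dilation (h : p.HolderConjugate p') (hpN : p < (N : ℝ)) (hsp : s < p)
    {F₁ D₁ F₂ D₂ : ℝ → ℝ} (hP₁ : IsProfile N p μ s F₁ D₁) (hP₂ : IsProfile N p μ s F₂ D₂)
    (hpos : 0 < phi p' (((N : ℝ) - p) / p) (μ / p) (dpow p (((N : ℝ) - p) / p))) :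
    ∃ τ, 0 < τ ∧ ∀ r, 0 < r → F₂ r = τ ^ (((N : ℝ) - p) / p) * F₁ (τ * r) := by
  obtain ⟨T, hT⟩ := (hP₁.isOrbit h hpN).eq_translate h (critExp_gt h.lt hpN hsp) hpos
    (hP₂.isOrbit h hpN)
  refine ⟨Real.exp T, Real.exp_pos T, fun r hr => ?_⟩
  have := hT (Real.log r)
  rw [emdenFst, emdenFst, Real.exp_log hr, Real.exp_add, Real.exp_log hr, mul_comm r, mul_add,
    Real.exp_add, mul_assoc] at this
  rw [← Real.exp_mul, mul_comm T]
  exact mul_left_cancel₀ (Real.exp_pos _).ne' this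

end Emden

/-- All of the theorem except regularity, which enters as `hprof`. -/
theorem classification_of_profiles {N : ℕ} {p μ s : ℝ} (hp : 1 < p) (hpN : p < (N : ℝ))
    (hμ : μ < (((N : ℝ) - p) / p) ^ p) (hsp : s < p)
    (hprof : ∀ u : Space N → ℝ, IsPosRadialSol p μ s u →
      ∃ F D, IsProfile N p μ s F D ∧ ∀ᵐ x, u x = F ‖x‖) :
    (∀ u₁ u₂ : Space N → ℝ, IsPosRadialSol p μ s u₁ → IsPosRadialSol p μ s u₂ →
        ∃ τ : ℝ, 0 < τ ∧ ∀ᵐ x, u₂ x = dilation p τ u₁ x) ∧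
    ∃ γ₁ γ₂ : ℝ, γ₁ < γ₂ ∧ (∀ γ : ℝ, Gam N p μ γ = 0 ↔ γ = γ₁ ∨ γ = γ₂) ∧
      (∀ u : Space N → ℝ, IsPosRadialSol p μ s u →
        ∃ C₁ C₂ : ℝ, 0 < C₁ ∧ 0 < C₂ ∧ HasAsymptotics γ₁ γ₂ C₁ C₂ u) ∧
      ∃ C₁ C₂ : ℝ, 0 < C₁ ∧ 0 < C₂ ∧ ∀ u : Space N → ℝ, IsPosRadialSol p μ s u →
          ∃ τ : ℝ, 0 < τ ∧ HasAsymptotics γ₁ γ₂ C₁ C₂ (dilation p τ u) := by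
  have h : p.HolderConjugate p.conjExponent := .conjExponent hp
  set p' := p.conjExponent
  have hp0 : p ≠ 0 := h.ne_zero
  have hδ : 0 < ((N : ℝ) - p) / p := div_pos (by linarith) (by linarith)
  have hpδ : p * (((N : ℝ) - p) / p) = N - p := by field_simp
  have hdiv : ∀ a : ℝ, p * (a / p') = (p - 1) * a := fun a => by
    rw [← h.div_conj_eq_sub_one]; ring
  have hGam : ∀ γ, Gam N p μ γ = -p * phi p' (((N : ℝ) - p) / p) (μ / p) (dpow p γ) := by
    intro γ
    rw [phi_dpow h, Gam]
    change _ - _ * dpow p γ + μ = _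
    have e1 := hdiv (|γ| ^ p)
    have e2 : p * (μ / p) = μ := by field_simp
    generalize ((N : ℝ) - p) / p = δ at hpδ
    linear_combination -e1 - e2 + dpow p γ * hpδ
  -- The peak value is `(δ^p - μ) / p` with `δ = (N - p) / p`; its positivity is the bound on `μ`.
  have hpos : 0 < phi p' (((N : ℝ) - p) / p) (μ / p) (dpow p (((N : ℝ) - p) / p)) := by
    rw [phi_dpow h, mul_dpow hp, abs_of_pos hδ]
    have e1 := hdiv ((((N : ℝ) - p) / p) ^ p)
    have e2 : p * (μ / p) = μ := by field_simp
    have : 0 < p * ((((N : ℝ) - p) / p) ^ p - (((N : ℝ) - p) / p) ^ p / p' - μ / p) := by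
      linarith
    exact pos_of_mul_pos_right this (by linarith)
  obtain ⟨w₁, w₂, hw₁, hw₂, h₁, h₂, hiff⟩ := exists_phi_zeros h hpos
  have hw₂0 : 0 < w₂ := (dpow_pos hδ).trans hw₂
  have huniq : ∀ u₁ u₂ : Space N → ℝ, IsPosRadialSol p μ s u₁ → IsPosRadialSol p μ s u₂ →
      ∃ τ : ℝ, 0 < τ ∧ ∀ᵐ x, u₂ x = dilation p τ u₁ x := by
    intro u₁ u₂ hu₁ hu₂
    obtain ⟨F₁, D₁, hP₁, e₁⟩ := hprof u₁ hu₁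
    obtain ⟨F₂, D₂, hP₂, e₂⟩ := hprof u₂ hu₂
    obtain ⟨τ, hτ, hF⟩ := hP₁.eq_dilation h hpN hsp hP₂ hpos
    refine ⟨τ, hτ, ?_⟩
    have hN : Nonempty (Fin N) := by
      refine ⟨⟨0, ?_⟩⟩
      have : (0 : ℝ) < N := by linarith
      exact_mod_cast this
    filter_upwards [e₂, ae_smul_of_ae e₁ hτ, Measure.ae_ne volume (0 : Space N)] with x h1 h2 h3
    rw [h1, dilation, h2, hF _ (norm_pos_iff.2 h3), norm_smul, Real.norm_of_nonneg hτ.le]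
  have hasym : ∀ u : Space N → ℝ, IsPosRadialSol p μ s u → ∃ C₁ C₂ : ℝ, 0 < C₁ ∧ 0 < C₂ ∧
      HasAsymptotics (dpow p' w₁) (dpow p' w₂) C₁ C₂ u := by
    intro u hu
    obtain ⟨F, D, hP, e⟩ := hprof u hu
    exact hP.hasAsymptotics h hpN hsp hpos h₁ h₂ hw₂0 hiff e
  refine ⟨huniq, dpow p' w₁, dpow p' w₂, strictMono_dpow h.symm.lt (hw₁.trans hw₂), ?_, hasym, ?_⟩
  · intro γ
    rw [hGam, mul_eq_zero, or_iff_right (neg_ne_zero.2 hp0)]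
    have hA := strictAntiOn_phi h (((N : ℝ) - p) / p) (μ / p)
    have hM := strictMonoOn_phi h (((N : ℝ) - p) / p) (μ / p)
    constructor
    · intro h0
      rcases le_total (dpow p γ) (dpow p (((N : ℝ) - p) / p)) with hle | hle
      · have := hM.injOn hle hw₁.le (h0.trans h₁.symm)
        exact Or.inl (by rw [← this, dpow_dpow h])
      · have := hA.injOn hle hw₂.le (h0.trans h₂.symm)
        exact Or.inr (by rw [← this, dpow_dpow h])
    · rintro (rfl | rfl)
      · rw [dpow_dpow h.symm, h₁]
      · rw [dpow_dpow h.symm, h₂]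
  -- Existence of a solution is not established. If there is one, its constants serve for all, since
  -- it is a dilation of every other; if there is none, any constants do.
  · by_cases hex : ∃ u : Space N → ℝ, IsPosRadialSol p μ s u
    · obtain ⟨u₀, hu₀⟩ := hex
      obtain ⟨C₁, C₂, hC₁, hC₂, hu₀'⟩ := hasym u₀ hu₀
      refine ⟨C₁, C₂, hC₁, hC₂, fun u hu => ?_⟩
      obtain ⟨τ, hτ, e⟩ := huniq u u₀ hu hu₀
      exact ⟨τ, hτ, hu₀'.congr (e.mono fun x hx => hx.symm)⟩
    · exact ⟨1, 1, one_pos, one_pos, fun u hu => absurd ⟨u, hu⟩ hex⟩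

end HardySobolev

/-! ### Radial test functions and the du Bois-Reymond lemma. -/

namespace HardySobolev

lemma integrable_mul_of_tsupport_subset {X : Type*} [TopologicalSpace X] [MeasurableSpace X]
    [OpensMeasurableSpace X] [T2Space X] {ν : Measure X} {U : Set X} {g ψ : X → ℝ}
    (hg : LocallyIntegrableOn g U ν) (hψ : Continuous ψ) (hc : HasCompactSupport ψ)
    (hs : tsupport ψ ⊆ U) : Integrable (fun x => g x * ψ x) ν := by
  have h1 : IntegrableOn (fun x => g x * ψ x) (tsupport ψ) ν :=
    (hg.integrableOn_compact_subset hs hc).mul_continuousOn_of_subset hψ.continuousOn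
      (isClosed_tsupport ψ).measurableSet hc le_rfl
  refine (integrableOn_iff_integrable_of_support_subset ?_).1 h1
  exact (Function.support_mul_subset_right g ψ).trans (subset_tsupport ψ)

/-- Smooth functions with compact support in the open half line. -/
structure IsRadialTest (η : ℝ → ℝ) : Prop where
  smooth : ContDiff ℝ ∞ η
  compact : HasCompactSupport η
  subset : tsupport η ⊆ Set.Ioi 0

namespace IsRadialTest

variable {η : ℝ → ℝ}

lemma deriv_isRadialTest (hη : IsRadialTest η) : IsRadialTest (deriv η) where
  smooth := (contDiff_infty_iff_deriv.1 hη.smooth).2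
  compact := hη.compact.deriv
  subset := (tsupport_deriv_subset (𝕜 := ℝ)).trans hη.subset

/-- Inserting `1` into the support puts the base point of all primitives inside the interval, and
makes the extremal argument valid for an empty support. -/
lemma exists_bounds (hη : IsRadialTest η) :
    ∃ α β : ℝ, 0 < α ∧ α < 1 ∧ 1 < β ∧ ∀ r, r ∉ Set.Ioo α β → η r = 0 := by
  have hK : IsCompact (insert 1 (tsupport η)) := hη.compact.isCompact.insert 1
  obtain ⟨a, ha, ha'⟩ := hK.exists_isLeast ⟨1, Set.mem_insert _ _⟩
  obtain ⟨b, hb, hb'⟩ := hK.exists_isGreatest ⟨1, Set.mem_insert _ _⟩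
  have ha0 : 0 < a := by
    rcases ha with rfl | ha
    · exact one_pos
    · exact hη.subset ha
  have ha1 : a ≤ 1 := ha' (Set.mem_insert _ _)
  have hb1 : 1 ≤ b := hb' (Set.mem_insert _ _)
  refine ⟨a / 2, b + 1, by linarith, by linarith, by linarith, fun r hr => ?_⟩
  by_contra hne
  have hmem : r ∈ insert 1 (tsupport η) := Or.inr (subset_tsupport η hne)
  exact hr ⟨by linarith [ha' hmem], by linarith [hb' hmem]⟩

lemma of_bounds (hs : ContDiff ℝ ∞ η) {α β : ℝ} (hα : 0 < α)
    (h : ∀ r, r ∉ Set.Icc α β → η r = 0) : IsRadialTest η where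
  smooth := hs
  compact := HasCompactSupport.intro isCompact_Icc h
  subset := by
    refine (closure_minimal (fun r hr => ?_) isClosed_Icc).trans
      (fun r (hr : r ∈ Set.Icc α β) => hα.trans_le hr.1)
    by_contra hne
    exact hr (h r hne)

lemma integrable_mul (hη : IsRadialTest η) {g : ℝ → ℝ} (hg : LocallyIntegrableOn g (Set.Ioi 0)) :
    Integrable fun r => g r * η r :=
  integrable_mul_of_tsupport_subset hg hη.smooth.continuous hη.compact hη.subset

lemma integrable (hη : IsRadialTest η) : Integrable η :=
  hη.smooth.continuous.integrable_of_hasCompactSupport hη.compact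

lemma exists_integral_eq_one : ∃ η, IsRadialTest η ∧ ∫ r, η r = 1 := by
  let f : ContDiffBump (2 : ℝ) := ⟨1 / 2, 1, by norm_num, by norm_num⟩
  refine ⟨f.normed volume, ⟨f.contDiff_normed, f.hasCompactSupport_normed, ?_⟩,
    f.integral_normed⟩
  rw [f.tsupport_normed_eq, Real.closedBall_eq_Icc]
  intro r hr
  have : (2 : ℝ) - 1 ≤ r := hr.1
  exact Set.mem_Ioi.2 (by linarith)

end IsRadialTest

lemma intervalIntegrable_of_pos {b : ℝ → ℝ} (hb : LocallyIntegrableOn b (Set.Ioi 0)) {x y : ℝ}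
    (hx : 0 < x) (hy : 0 < y) : IntervalIntegrable b volume x y := by
  rw [intervalIntegrable_iff]
  refine (hb.integrableOn_compact_subset ?_ isCompact_uIcc).mono_set Set.uIoc_subset_uIcc
  intro r hr
  exact (lt_min hx hy).trans_le hr.1

lemma continuousOn_primitive {b : ℝ → ℝ} (hb : LocallyIntegrableOn b (Set.Ioi 0)) :
    ContinuousOn (fun r => ∫ t in (1 : ℝ)..r, b t) (Set.Ioi 0) := by
  intro r hr
  have hr : 0 < r := hr
  have h1 : ContinuousOn (fun r => ∫ t in (1 : ℝ)..r, b t)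
      (Set.uIcc (min 1 r / 2) (max 1 r + 1)) := by
    have hm : 0 < min 1 r := lt_min one_pos hr
    refine intervalIntegral.continuousOn_primitive_interval' (intervalIntegrable_of_pos hb
      (by positivity) (by positivity)) ?_
    rw [Set.uIcc_of_le (by linarith [min_le_left 1 r, le_max_left 1 r])]
    exact ⟨by linarith [min_le_left 1 r], by linarith [le_max_left 1 r]⟩
  refine (h1.continuousAt ?_).continuousWithinAt
  have hm : 0 < min 1 r := lt_min one_pos hr
  rw [Set.uIcc_of_le (by linarith [min_le_left 1 r, le_max_left 1 r])]
  exact Icc_mem_nhds (by linarith [min_le_right 1 r]) (by linarith [le_max_right 1 r])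

/-- The primitive of a merely integrable function is absolutely continuous, which suffices for
integration by parts. -/
lemma integral_primitive_mul_deriv {b η : ℝ → ℝ} (hb : LocallyIntegrableOn b (Set.Ioi 0))
    (hη : IsRadialTest η) :
    ∫ r, (∫ t in (1 : ℝ)..r, b t) * deriv η r = -∫ r, b r * η r := by
  obtain ⟨α, β, hα, hα1, hβ, hz⟩ := hη.exists_bounds
  have hαβ : α < β := hα1.trans hβ
  have hI := intervalIntegrable_of_pos hb hα (one_pos.trans hβ)
  have h1 : (1 : ℝ) ∈ Set.uIcc α β := by
    rw [Set.uIcc_of_le hαβ.le]; exact ⟨hα1.le, hβ.le⟩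
  have hd : ∀ r, r ∉ Set.Icc α β → deriv η r = 0 := by
    intro r hr
    have : η =ᶠ[𝓝 r] fun _ => 0 := by
      filter_upwards [isClosed_Icc.isOpen_compl.mem_nhds hr] with x hx
      exact hz x fun h => hx (Set.Ioo_subset_Icc_self h)
    rw [this.deriv_eq, deriv_const]
  have hdα : ∀ g : ℝ → ℝ, ∫ r, g r * deriv η r = ∫ r in α..β, g r * deriv η r := by
    intro g
    rw [intervalIntegral.integral_of_le hαβ.le, ← integral_Icc_eq_integral_Ioc,
      setIntegral_eq_integral_of_forall_compl_eq_zero]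
    intro r hr; rw [hd r hr, mul_zero]
  have hη' : ∀ g : ℝ → ℝ, ∫ r, g r * η r = ∫ r in α..β, g r * η r := by
    intro g
    rw [intervalIntegral.integral_of_le hαβ.le, ← integral_Icc_eq_integral_Ioc,
      setIntegral_eq_integral_of_forall_compl_eq_zero]
    intro r hr; rw [hz r fun h => hr (Set.Ioo_subset_Icc_self h), mul_zero]
  have hac := hI.absolutelyContinuousOnInterval_intervalIntegral h1
  have hac' : AbsolutelyContinuousOnInterval η α β :=
    ((hη.smooth.of_le (by simp)).contDiffOn).absolutelyContinuousOnInterval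
  rw [hdα, hη', hac.integral_mul_deriv_eq_deriv_mul hac', hz α fun h => lt_irrefl _ h.1,
    hz β fun h => lt_irrefl _ h.2, mul_zero, mul_zero, sub_zero, zero_sub]
  congr 1
  refine intervalIntegral.integral_congr_ae ?_
  filter_upwards [hI.ae_hasDerivAt_integral] with x hx hx'
  rw [(hx (Set.uIoc_subset_uIcc hx') 1 h1).deriv]

/-- A test function of mean zero is the derivative of a test function. Subtracting from `ψ` a
multiple of a fixed `η₀` of mean one reduces any `ψ` to this case; the constant is the integral of
`g` against `η₀`. -/
lemma ae_const_of_integral_mul_deriv_eq_zero {g : ℝ → ℝ} (hg : LocallyIntegrableOn g (Set.Ioi 0))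
    (h : ∀ η, IsRadialTest η → ∫ r, g r * deriv η r = 0) :
    ∃ c, ∀ᵐ r : ℝ, 0 < r → g r = c := by
  obtain ⟨η₀, hη₀, hη₀1⟩ := IsRadialTest.exists_integral_eq_one
  set c := ∫ r, g r * η₀ r with hc
  refine ⟨c, ?_⟩
  have hlc : LocallyIntegrableOn (fun r => g r - c) (Set.Ioi 0) :=
    hg.sub (locallyIntegrableOn_const c)
  have := isOpen_Ioi.ae_eq_zero_of_integral_contDiff_smul_eq_zero hlc ?_
  · filter_upwards [this] with r hr hr0
    linarith [hr hr0]
  intro ψ hψs hψc hψt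
  have hψ : IsRadialTest ψ := ⟨hψs, hψc, hψt⟩
  set m := ∫ r, ψ r with hm
  set ζ : ℝ → ℝ := fun r => ψ r - m * η₀ r with hζ
  have hζs : ContDiff ℝ ∞ ζ := hψs.sub (contDiff_const.mul hη₀.smooth)
  have hζi : ∀ a b, IntervalIntegrable ζ volume a b := fun a b =>
    hζs.continuous.intervalIntegrable a b
  have hζint : Integrable ζ := hψ.integrable.sub (hη₀.integrable.const_mul m)
  have hζ0 : ∫ r, ζ r = 0 := by
    rw [hζ, integral_sub hψ.integrable (hη₀.integrable.const_mul m), integral_const_mul, hη₀1]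
    simp [hm]
  obtain ⟨α₁, β₁, hα₁, hα₁', hβ₁, hz₁⟩ := hψ.exists_bounds
  obtain ⟨α₂, β₂, hα₂, hα₂', hβ₂, hz₂⟩ := hη₀.exists_bounds
  have hζz : ∀ r, r ∉ Set.Ioo (min α₁ α₂) (max β₁ β₂) → ζ r = 0 := by
    intro r hr
    have e₁ := hz₁ r fun h => hr ⟨(min_le_left _ _).trans_lt h.1, h.2.trans_le (le_max_left _ _)⟩
    have e₂ := hz₂ r fun h => hr ⟨(min_le_right _ _).trans_lt h.1, h.2.trans_le (le_max_right _ _)⟩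
    rw [hζ]; simp [e₁, e₂]
  set α := min α₁ α₂
  set β := max β₁ β₂
  have hα : 0 < α := lt_min hα₁ hα₂
  have hαβ : α ≤ β := (min_le_left _ _).trans ((hα₁'.trans hβ₁).le.trans (le_max_left _ _))
  set η : ℝ → ℝ := fun r => ∫ t in α..r, ζ t with hη
  have hηd : ∀ r, HasDerivAt η (ζ r) r := fun r =>
    intervalIntegral.integral_hasDerivAt_right (hζi _ _)
      hζs.continuous.stronglyMeasurable.stronglyMeasurableAtFilter hζs.continuous.continuousAt
  have hηde : deriv η = ζ := funext fun r => (hηd r).deriv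
  have hηt : IsRadialTest η := by
    refine IsRadialTest.of_bounds (α := α) (β := β) ?_ hα fun r hr => ?_
    · rw [contDiff_infty_iff_deriv, hηde]
      exact ⟨fun r => (hηd r).differentiableAt, hζs⟩
    · rw [Set.mem_Icc, not_and_or, not_le, not_le] at hr
      rcases hr with hr | hr
      · refine (intervalIntegral.integral_congr (g := fun _ => (0 : ℝ)) fun t ht => ?_).trans
          (by simp)
        rw [Set.uIcc_of_ge hr.le] at ht
        exact hζz t fun h => absurd h.1 (not_lt.2 ht.2)
      · rw [hη]
        simp only
        rw [intervalIntegral.integral_of_le (hαβ.trans hr.le),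
          setIntegral_eq_integral_of_forall_compl_eq_zero, hζ0]
        intro t ht
        exact hζz t fun h => ht ⟨h.1, h.2.le.trans hr.le⟩
  have hmain := h η hηt
  rw [hηde] at hmain
  have i₁ := hψ.integrable_mul hg
  have i₂ := hη₀.integrable_mul hg
  have e : (fun r => g r * ζ r) = fun r => g r * ψ r - m * (g r * η₀ r) := by
    funext r; rw [hζ]; ring
  rw [e, integral_sub i₁ (i₂.const_mul m), integral_const_mul, ← hc] at hmain
  have e' : (fun r => ψ r • (g r - c)) = fun r => g r * ψ r - c * ψ r := by
    funext r; rw [smul_eq_mul]; ring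
  rw [e', integral_sub i₁ (hψ.integrable.const_mul c), integral_const_mul, ← hm]
  linarith

/-- The lemma of du Bois-Reymond on the half line. -/
theorem eq_primitive_of_integral_mul_deriv {a b : ℝ → ℝ}
    (ha : LocallyIntegrableOn a (Set.Ioi 0)) (hb : LocallyIntegrableOn b (Set.Ioi 0))
    (h : ∀ η, IsRadialTest η → ∫ r, a r * deriv η r = -∫ r, b r * η r) :
    ∃ c, ∀ᵐ r : ℝ, 0 < r → a r = c + ∫ t in (1 : ℝ)..r, b t := by
  have hB : LocallyIntegrableOn (fun r => ∫ t in (1 : ℝ)..r, b t) (Set.Ioi 0) :=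
    (continuousOn_primitive hb).locallyIntegrableOn measurableSet_Ioi
  obtain ⟨c, hc⟩ := ae_const_of_integral_mul_deriv_eq_zero (ha.sub hB) fun η hη => by
    have i₁ := hη.deriv_isRadialTest.integrable_mul ha
    have i₂ := hη.deriv_isRadialTest.integrable_mul hB
    have e : (fun r => (a - fun r => ∫ t in (1 : ℝ)..r, b t) r * deriv η r) =
        fun r => a r * deriv η r - (∫ t in (1 : ℝ)..r, b t) * deriv η r := by
      funext r; rw [Pi.sub_apply, sub_mul]
    rw [e, integral_sub i₁ i₂, h η hη, integral_primitive_mul_deriv hb hη, sub_self]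
  refine ⟨c, hc.mono fun r hr hr0 => ?_⟩
  have := hr hr0
  rw [Pi.sub_apply] at this
  linarith

end HardySobolev

/-! ### Polar coordinates and radial functions. -/

namespace HardySobolev

section Polar

variable {E : Type*} [NormedAddCommGroup E] [NormedSpace ℝ E] [MeasurableSpace E] [BorelSpace E]
  [FiniteDimensional ℝ E] [Nontrivial E] (ν : Measure E) [ν.IsAddHaarMeasure]

/-- Integration in polar coordinates. -/
lemma integrableOn_and_integral_polar {Φ : E → ℝ} (hΦ : Integrable Φ ν) :
    IntegrableOn (fun r : ℝ => r ^ (Module.finrank ℝ E - 1) *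
      ∫ θ : Metric.sphere (0 : E) 1, Φ (r • (θ : E)) ∂ν.toSphere) (Set.Ioi 0) ∧
    ∫ x, Φ x ∂ν = ∫ r in Set.Ioi (0 : ℝ), r ^ (Module.finrank ℝ E - 1) *
      ∫ θ : Metric.sphere (0 : E) 1, Φ (r • (θ : E)) ∂ν.toSphere := by
  set n := Module.finrank ℝ E - 1
  set Ψ : Metric.sphere (0 : E) 1 × Set.Ioi (0 : ℝ) → ℝ := fun y => Φ ((y.2 : ℝ) • (y.1 : E))
    with hΨ
  set H : ℝ → ℝ := fun r => ∫ θ : Metric.sphere (0 : E) 1, Φ (r • (θ : E)) ∂ν.toSphere with hH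
  have hmp := ν.measurePreserving_homeomorphUnitSphereProd
  have hcomp : ∀ x : ({(0 : E)}ᶜ : Set E), Ψ (homeomorphUnitSphereProd E x) = Φ x := by
    intro x
    rw [hΨ]
    simp only
    congr 1
    have hx : ‖(x : E)‖ ≠ 0 := norm_ne_zero_iff.2 x.2
    simp [smul_smul, hx]
  have hΦ' : Integrable (fun x : ({(0 : E)}ᶜ : Set E) => Φ x) (ν.comap (↑)) := by
    have := (integrableOn_iff_comap_subtypeVal (measurableSet_singleton (0 : E)).compl).1
      (hΦ.integrableOn (s := {(0 : E)}ᶜ))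
    exact this
  have hint : Integrable Ψ (ν.toSphere.prod (.volumeIoiPow n)) := by
    rw [← hmp.integrable_comp_emb (Homeomorph.measurableEmbedding _)]
    exact hΦ'.congr (Eventually.of_forall fun x => (hcomp x).symm)
  have hI : ∫ x, Φ x ∂ν = ∫ y, Ψ y ∂(ν.toSphere.prod (.volumeIoiPow n)) := by
    rw [← hmp.integral_comp (Homeomorph.measurableEmbedding _)]
    simp_rw [hcomp]
    rw [integral_subtype_comap (measurableSet_singleton _).compl fun x => Φ x,
      restrict_compl_singleton]
  have hr : Integrable (fun r : Set.Ioi (0 : ℝ) => H r) (.volumeIoiPow n) :=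
    hint.integral_prod_right
  constructor
  · rw [Measure.volumeIoiPow, integrable_withDensity_iff_integrable_smul' (by fun_prop)
      (by simp)] at hr
    rw [integrableOn_iff_comap_subtypeVal measurableSet_Ioi]
    refine hr.congr (Eventually.of_forall fun r => ?_)
    have : (0 : ℝ) ≤ (r : ℝ) ^ n := pow_nonneg (le_of_lt r.2) _
    simp [ENNReal.toReal_ofReal this, hH]
  · rw [hI, integral_prod_symm _ hint]
    change ∫ r : Set.Ioi (0 : ℝ), H r ∂(Measure.volumeIoiPow n) = _
    simp only [Measure.volumeIoiPow, ENNReal.ofReal]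
    rw [integral_withDensity_eq_integral_smul,
      integral_subtype_comap measurableSet_Ioi fun a => Real.toNNReal (a ^ n) • H a]
    · refine setIntegral_congr_fun measurableSet_Ioi fun x hx => ?_
      rw [NNReal.smul_def, Real.coe_toNNReal _ (pow_nonneg (le_of_lt hx) _), smul_eq_mul]
    · exact (measurable_subtype_coe.pow_const _).real_toNNReal

/-- The indicator of a measurable null set of radii has zero integral in polar coordinates. The
measurable hull is needed since `P` may fail on a nonmeasurable set. -/
lemma ae_norm_of_ae {P : ℝ → Prop} (hP : ∀ᵐ r : ℝ, 0 < r → P r) : ∀ᵐ x ∂ν, x ≠ 0 → P ‖x‖ := by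
  set Z := toMeasurable volume {r : ℝ | ¬(0 < r → P r)} with hZ
  have hZ0 : volume Z = 0 := by rw [hZ, measure_toMeasurable]; exact hP
  have hZm : MeasurableSet Z := measurableSet_toMeasurable _ _
  set f : ℝ → ℝ := Z.indicator 1 with hf
  have hf0 : f =ᵐ[volume] 0 := indicator_meas_zero hZ0
  have hint : Integrable (fun x : E => f ‖x‖) ν := by
    rw [integrable_fun_norm_addHaar]
    refine (integrableOn_zero (s := Set.Ioi (0 : ℝ)) (μ := volume)).congr ?_
    filter_upwards [ae_restrict_of_ae hf0] with r hr
    simp [hr]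
  have h0 : ∫ x, f ‖x‖ ∂ν = 0 := by
    rw [integral_fun_norm_addHaar]
    have : ∫ y in Set.Ioi (0 : ℝ), y ^ (Module.finrank ℝ E - 1) • f y = 0 := by
      refine integral_eq_zero_of_ae ?_
      filter_upwards [ae_restrict_of_ae hf0] with r hr
      simp [hr]
    rw [this]; simp
  have hnn : 0 ≤ fun x : E => f ‖x‖ := fun x =>
    Set.indicator_nonneg (fun _ _ => zero_le_one) _
  filter_upwards [(integral_eq_zero_iff_of_nonneg hnn hint).1 h0] with x hx hx0
  by_contra hcon
  have : ‖x‖ ∈ Z := subset_toMeasurable _ _ fun h => hcon (h (norm_pos_iff.2 hx0))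
  simp [hf, this] at hx

lemma isCompact_annulus {E : Type*} [NormedAddCommGroup E] [NormedSpace ℝ E]
    [FiniteDimensional ℝ E] (α β : ℝ) : IsCompact {x : E | α ≤ ‖x‖ ∧ ‖x‖ ≤ β} := by
  refine (isCompact_closedBall (0 : E) β).of_isClosed_subset ?_ fun x hx => by simpa using hx.2
  exact (isClosed_le continuous_const continuous_norm).inter
    (isClosed_le continuous_norm continuous_const)

lemma locallyIntegrableOn_Ioi_of_Icc {f : ℝ → ℝ}
    (h : ∀ α β, 0 < α → IntegrableOn f (Set.Icc α β)) : LocallyIntegrableOn f (Set.Ioi 0) := by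
  intro r hr
  have hr : 0 < r := hr
  exact ⟨Set.Icc (r / 2) (r + 1), mem_nhdsWithin_of_mem_nhds
    (Icc_mem_nhds (by linarith) (by linarith)), h _ _ (by positivity)⟩

lemma integrableOn_Icc_of_pow_mul {f : ℝ → ℝ} {n : ℕ} {α β : ℝ} (hα : 0 < α)
    (h : IntegrableOn (fun r => r ^ n * f r) (Set.Icc α β)) : IntegrableOn f (Set.Icc α β) := by
  have hc : ContinuousOn (fun r : ℝ => (r ^ n)⁻¹) (Set.Icc α β) :=
    (continuousOn_pow n).inv₀ fun r hr => (pow_pos (hα.trans_le hr.1) _).ne'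
  refine (h.continuousOn_mul hc isCompact_Icc).congr ?_
  filter_upwards [ae_restrict_mem measurableSet_Icc] with r hr
  have : r ^ n ≠ 0 := (pow_pos (hα.trans_le hr.1) _).ne'
  field_simp

/-- Here `g` is not assumed radial: the density is its integral over spheres, with the Jacobian
`r^n` included. -/
lemma exists_radial_density {g : E → ℝ} (hg : LocallyIntegrable g ν) :
    ∃ h : ℝ → ℝ, LocallyIntegrableOn h (Set.Ioi 0) ∧
      ∀ b, IsRadialTest b → ∫ x, g x * b ‖x‖ ∂ν = ∫ r, h r * b r := by
  set n := Module.finrank ℝ E - 1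
  set H : ℝ → ℝ := fun r => ∫ θ : Metric.sphere (0 : E) 1, g (r • (θ : E)) ∂ν.toSphere with hH
  have hmul : ∀ (k : ℝ → ℝ) (r : ℝ), 0 < r →
      ∫ θ : Metric.sphere (0 : E) 1, g (r • (θ : E)) * k ‖r • (θ : E)‖ ∂ν.toSphere = H r * k r := by
    intro k r hr
    have : ∀ θ : Metric.sphere (0 : E) 1, ‖r • (θ : E)‖ = r := fun θ => by
      rw [norm_smul, Real.norm_of_nonneg hr.le, norm_eq_of_mem_sphere, mul_one]
    simp_rw [this]
    rw [integral_mul_const]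
  refine ⟨fun r => r ^ n * H r, locallyIntegrableOn_Ioi_of_Icc fun α β hα => ?_, fun b hb => ?_⟩
  · set k : ℝ → ℝ := (Set.Icc α β).indicator 1 with hk
    have hi : Integrable (fun x => g x * k ‖x‖) ν := by
      have hK := isCompact_annulus (E := E) α β
      have := (hg.integrableOn_isCompact hK).integrable_indicator hK.measurableSet
      refine this.congr (Eventually.of_forall fun x => ?_)
      by_cases hx : α ≤ ‖x‖ ∧ ‖x‖ ≤ β
      · simp [Set.indicator, hk, hx]
      · simp [Set.indicator, hk, hx]
    have h1 := (integrableOn_and_integral_polar ν hi).1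
    have hsub : Set.Icc α β ⊆ Set.Ioi 0 := fun r hr => hα.trans_le hr.1
    refine (h1.mono_set hsub).congr ?_
    · filter_upwards [ae_restrict_mem measurableSet_Icc] with r hr
      rw [hmul k r (hα.trans_le hr.1)]
      simp [hk, hr, n]
  · have hi : Integrable (fun x => g x * b ‖x‖) ν := by
      have hc : Continuous fun x : E => b ‖x‖ := hb.smooth.continuous.comp continuous_norm
      have hcs : HasCompactSupport fun x : E => b ‖x‖ := by
        obtain ⟨α, β, -, -, -, hz⟩ := hb.exists_bounds
        refine HasCompactSupport.intro (isCompact_annulus (E := E) α β) fun x hx => hz _ fun h => ?_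
        exact hx ⟨h.1.le, h.2.le⟩
      exact hg.integrable_smul_right_of_hasCompactSupport hc hcs
    rw [(integrableOn_and_integral_polar ν hi).2,
      ← setIntegral_eq_integral_of_forall_compl_eq_zero (s := Set.Ioi (0 : ℝ))
        (f := fun r => r ^ n * H r * b r)]
    · refine setIntegral_congr_fun measurableSet_Ioi fun r hr => ?_
      rw [hmul b r hr, mul_assoc]
    · intro r hr
      rw [image_eq_zero_of_notMem_tsupport fun h => hr (hb.subset h), mul_zero]

lemma locallyIntegrableOn_of_norm {f : ℝ → ℝ} (hf : LocallyIntegrable (fun x : E => f ‖x‖) ν) :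
    LocallyIntegrableOn f (Set.Ioi 0) := by
  refine locallyIntegrableOn_Ioi_of_Icc fun α β hα => ?_
  have hK := isCompact_annulus (E := E) α β
  have h1 := (hf.integrableOn_isCompact hK).integrable_indicator hK.measurableSet
  have h2 : Integrable (fun x : E => (Set.Icc α β).indicator f ‖x‖) ν := by
    refine h1.congr (Eventually.of_forall fun x => ?_)
    simp [Set.indicator]
  rw [integrable_fun_norm_addHaar] at h2
  refine integrableOn_Icc_of_pow_mul hα (n := Module.finrank ℝ E - 1)
    ((h2.mono_set (fun r hr => hα.trans_le hr.1)).congr ?_)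
  filter_upwards [ae_restrict_mem measurableSet_Icc] with r hr
  simp [hr]

lemma integrable_annulus {f : ℝ → ℝ} (hf : LocallyIntegrableOn f (Set.Ioi 0)) {α β : ℝ}
    (hα : 0 < α) : Integrable (fun x : E => (Set.Icc α β).indicator f ‖x‖) ν := by
  rw [integrable_fun_norm_addHaar]
  have h1 : IntegrableOn (fun r => r ^ (Module.finrank ℝ E - 1) * f r) (Set.Icc α β) :=
    (hf.integrableOn_compact_subset (fun r hr => hα.trans_le hr.1) isCompact_Icc).continuousOn_mul
      (continuousOn_pow _) isCompact_Icc
  have h2 := (h1.integrable_indicator measurableSet_Icc).integrableOn (s := Set.Ioi (0 : ℝ))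
  refine h2.congr (Eventually.of_forall fun r => ?_)
  by_cases hr : r ∈ Set.Icc α β <;> simp [hr]

lemma locallyIntegrableOn_norm {f : ℝ → ℝ} (hf : LocallyIntegrableOn f (Set.Ioi 0)) :
    LocallyIntegrableOn (fun x : E => f ‖x‖) {0}ᶜ ν := by
  intro x hx
  have hx : 0 < ‖x‖ := norm_pos_iff.2 hx
  have h1 := (integrable_annulus ν hf (α := ‖x‖ / 2) (β := ‖x‖ + 1) (by positivity)).integrableOn
    (s := {y : E | ‖x‖ / 2 ≤ ‖y‖ ∧ ‖y‖ ≤ ‖x‖ + 1})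
  refine ⟨{y | ‖x‖ / 2 ≤ ‖y‖ ∧ ‖y‖ ≤ ‖x‖ + 1}, mem_nhdsWithin_of_mem_nhds ?_, ?_⟩
  · filter_upwards [continuous_norm.continuousAt.preimage_mem_nhds
      (Icc_mem_nhds (show ‖x‖ / 2 < ‖x‖ by linarith) (show ‖x‖ < ‖x‖ + 1 by linarith))] with y hy
    exact hy
  · refine h1.congr ?_
    filter_upwards [ae_restrict_mem (isCompact_annulus (E := E) _ _).measurableSet] with y hy
    exact Set.indicator_of_mem (show ‖y‖ ∈ Set.Icc (‖x‖ / 2) (‖x‖ + 1) from hy) f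

end Polar

section RadialTest

variable {E : Type*} [NormedAddCommGroup E] [InnerProductSpace ℝ E]

lemma IsRadialTest.contDiff_norm {η : ℝ → ℝ} (hη : IsRadialTest η) :
    ContDiff ℝ ∞ fun x : E => η ‖x‖ := by
  rw [contDiff_iff_contDiffAt]
  intro x
  rcases eq_or_ne x 0 with rfl | hx
  · obtain ⟨α, β, hα, -, -, hz⟩ := hη.exists_bounds
    have : (fun x : E => η ‖x‖) =ᶠ[𝓝 0] fun _ => 0 := by
      filter_upwards [Metric.ball_mem_nhds (0 : E) hα] with x hx
      exact hz _ fun h => absurd h.1 (not_lt.2 (by simpa using (mem_ball_zero_iff.1 hx).le))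
    exact contDiffAt_const.congr_of_eventuallyEq this
  · exact (hη.smooth.contDiffAt).comp x (contDiffAt_norm ℝ hx)

lemma IsRadialTest.hasCompactSupport_norm [FiniteDimensional ℝ E] {η : ℝ → ℝ}
    (hη : IsRadialTest η) : HasCompactSupport fun x : E => η ‖x‖ := by
  obtain ⟨α, β, -, -, -, hz⟩ := hη.exists_bounds
  refine HasCompactSupport.intro (isCompact_closedBall (0 : E) β) fun x hx => hz _ fun h => ?_
  exact hx (by simpa using h.2.le)

end RadialTest

end HardySobolev

/-! ### Weak gradients. -/

namespace HardySobolev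

/-- This allows factors such as `r^{-N}`, singular at the origin, where `η` vanishes. -/
lemma IsRadialTest.mul_contDiffOn {η k : ℝ → ℝ} (hη : IsRadialTest η)
    (hk : ContDiffOn ℝ ∞ k (Set.Ioi 0)) : IsRadialTest fun r => η r * k r where
  smooth := by
    rw [contDiff_iff_contDiffAt]
    intro r
    by_cases hr : r ∈ tsupport fun r => η r * k r
    swap
    · exact contDiffAt_const.congr_of_eventuallyEq (notMem_tsupport_iff_eventuallyEq.1 hr)
    have hr0 : r ∈ Set.Ioi (0 : ℝ) := hη.subset (tsupport_mul_subset_left hr)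
    exact hη.smooth.contDiffAt.mul (hk.contDiffAt (isOpen_Ioi.mem_nhds hr0))
  compact := hη.compact.mul_right
  subset := (tsupport_mul_subset_left (f := η) (g := k)).trans hη.subset

lemma tendsto_integral_inner_of_eLpNorm {X H : Type*} [MeasurableSpace X] {ν : Measure X}
    [NormedAddCommGroup H] [InnerProductSpace ℝ H] {P Q : ℝ} (hPQ : P.HolderConjugate Q)
    {w : ℕ → X → H} {w₀ g : X → H} (hw : ∀ n, MemLp (w n) (ENNReal.ofReal P) ν)
    (hw₀ : MemLp w₀ (ENNReal.ofReal P) ν) (hg : MemLp g (ENNReal.ofReal Q) ν)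
    (hlim : Tendsto (fun n => eLpNorm (fun x => w n x - w₀ x) (ENNReal.ofReal P) ν) atTop (𝓝 0)) :
    Tendsto (fun n => ∫ x, inner ℝ (w n x) (g x) ∂ν) atTop (𝓝 (∫ x, inner ℝ (w₀ x) (g x) ∂ν)) := by
  have := hPQ.ennrealOfReal
  have hbound : ∀ a : X → H, ∀ᵐ x ∂ν, ‖(inner ℝ (a x) (g x) : ℝ)‖₊ ≤ 1 * ‖a x‖₊ * ‖g x‖₊ :=
    fun a => Eventually.of_forall fun x => by
      rw [one_mul]; exact nnnorm_inner_le_nnnorm _ _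
  have hint : ∀ a : X → H, MemLp a (ENNReal.ofReal P) ν →
      Integrable (fun x => (inner ℝ (a x) (g x) : ℝ)) ν := fun a ha =>
    memLp_one_iff_integrable.1 (MemLp.of_bilin (fun x y => (inner ℝ x y : ℝ)) 1 ha hg
      (ha.1.inner hg.1) (hbound a))
  refine tendsto_integral_of_L1' _ (hint w₀ hw₀).1 (Eventually.of_forall fun n => hint _ (hw n)) ?_
  have hlim' : Tendsto (fun n => eLpNorm (fun x => w n x - w₀ x) (ENNReal.ofReal P) ν *
      eLpNorm g (ENNReal.ofReal Q) ν) atTop (𝓝 0) := by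
    have := ENNReal.Tendsto.mul_const (b := eLpNorm g (ENNReal.ofReal Q) ν) hlim
      (Or.inr hg.eLpNorm_ne_top)
    simpa using this
  refine tendsto_of_tendsto_of_tendsto_of_le_of_le tendsto_const_nhds hlim'
    (fun _ => zero_le) fun n => ?_
  have h1 := eLpNorm_le_eLpNorm_mul_eLpNorm_of_nnnorm (p := ENNReal.ofReal P)
    (q := ENNReal.ofReal Q) (r := 1) ((hw n).sub hw₀).1 hg.1 (fun x y => (inner ℝ x y : ℝ)) 1
    (hbound _)
  rw [ENNReal.coe_one, one_mul] at h1
  refine le_trans (le_of_eq ?_) h1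
  congr 1
  funext x
  simp [inner_sub_left]

section WeakGradient

variable {N : ℕ}

/-- `G` is a weak gradient of `u`. -/
def IsWeakGradient (u : Space N → ℝ) (G : Space N → Space N) : Prop :=
  ∀ ψ : Space N → ℝ, IsTest ψ → ∀ v : Space N,
    ∫ x, u x * fderiv ℝ ψ x v = -∫ x, inner ℝ (G x) v * ψ x

lemma inner_gradient_left' (φ : Space N → ℝ) (x v : Space N) :
    inner ℝ (gradient φ x) v = fderiv ℝ φ x v := by
  rw [gradient, InnerProductSpace.toDual_symm_apply]

lemma IsTest.continuous_gradient {φ : Space N → ℝ} (h : IsTest φ) :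
    Continuous (gradient φ) :=
  (InnerProductSpace.toDual ℝ (Space N)).symm.continuous.comp
    (h.1.continuous_fderiv (by simp))

lemma IsTest.hasCompactSupport_gradient {φ : Space N → ℝ} (h : IsTest φ) :
    HasCompactSupport (gradient φ) :=
  (h.2.fderiv ℝ).comp_left (map_zero _)

lemma IsTest.continuous_fderiv_apply {φ : Space N → ℝ} (h : IsTest φ) (v : Space N) :
    Continuous fun x => fderiv ℝ φ x v :=
  (h.1.continuous_fderiv (by simp)).clm_apply continuous_const

lemma IsTest.hasCompactSupport_fderiv_apply {φ : Space N → ℝ} (h : IsTest φ) (v : Space N) :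
    HasCompactSupport fun x => fderiv ℝ φ x v :=
  (h.2.fderiv ℝ).comp_left (g := fun L : Space N →L[ℝ] ℝ => L v) rfl

lemma one_lt_critExp_zero {p : ℝ} (hp : 1 < p) (hpN : p < (N : ℝ)) : 1 < critExp N p 0 :=
  hp.trans (critExp_gt hp hpN (by linarith))

/-- Integration by parts holds for the approximating test functions; by Hölder both sides pass to
the limit. -/
lemma MemD1p.isWeakGradient {p : ℝ} (hp : 1 < p) (hpN : p < (N : ℝ)) {u : Space N → ℝ}
    {G : Space N → Space N} (h : MemD1p p u G) : IsWeakGradient u G := by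
  obtain ⟨hu, hG, φ, hφ, hφu, hφG⟩ := h
  intro ψ hψ v
  have l1 := tendsto_integral_inner_of_eLpNorm
    (Real.HolderConjugate.conjExponent (one_lt_critExp_zero hp hpN))
    (w := φ) (g := fun x => fderiv ℝ ψ x v)
    (fun n => (hφ n).1.continuous.memLp_of_hasCompactSupport (hφ n).2) hu
    ((hψ.continuous_fderiv_apply v).memLp_of_hasCompactSupport
      (hψ.hasCompactSupport_fderiv_apply v)) hφu
  have hcv : Continuous fun x => ψ x • v := hψ.1.continuous.smul continuous_const
  have hsv : HasCompactSupport fun x => ψ x • v := hψ.2.smul_right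
  have l2 := tendsto_integral_inner_of_eLpNorm (Real.HolderConjugate.conjExponent hp)
    (w := fun n => gradient (φ n)) (g := fun x => ψ x • v)
    (fun n => (hφ n).continuous_gradient.memLp_of_hasCompactSupport
      (hφ n).hasCompactSupport_gradient) hG (hcv.memLp_of_hasCompactSupport hsv) hφG
  have hibp : ∀ n, ∫ x, inner ℝ (φ n x) (fderiv ℝ ψ x v) =
      -∫ x, inner ℝ (gradient (φ n) x) (ψ x • v) := by
    intro n
    have e1 : ∀ x, (inner ℝ (φ n x) (fderiv ℝ ψ x v) : ℝ) = φ n x * fderiv ℝ ψ x v := fun x => by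
      simp [mul_comm]
    have e2 : ∀ x, (inner ℝ (gradient (φ n) x) (ψ x • v) : ℝ) = fderiv ℝ (φ n) x v * ψ x :=
      fun x => by rw [inner_smul_right, inner_gradient_left', mul_comm]
    simp_rw [e1, e2]
    refine integral_mul_fderiv_eq_neg_fderiv_mul_of_integrable ?_ ?_ ?_
      (fun x _ => ((hφ n).1.differentiable (by simp)).differentiableAt)
      (fun x _ => (hψ.1.differentiable (by simp)).differentiableAt)
    · exact (((hφ n).continuous_fderiv_apply v).mul hψ.1.continuous).integrable_of_hasCompactSupport
        hψ.2.mul_left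
    · exact ((hφ n).1.continuous.mul (hψ.continuous_fderiv_apply v)).integrable_of_hasCompactSupport
        (hφ n).2.mul_right
    · exact ((hφ n).1.continuous.mul hψ.1.continuous).integrable_of_hasCompactSupport
        (hφ n).2.mul_right
  have := tendsto_nhds_unique l1 (l2.neg.congr fun n => (hibp n).symm)
  simp_rw [inner_smul_right, mul_comm (ψ _)] at this
  rw [← this]
  refine integral_congr_ae (Eventually.of_forall fun x => ?_)
  simp [mul_comm]

lemma IsRadialTest.isTest_norm {η : ℝ → ℝ} (hη : IsRadialTest η) :
    IsTest fun x : Space N => η ‖x‖ := ⟨hη.contDiff_norm, hη.hasCompactSupport_norm⟩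

variable [Nontrivial (Space N)]

lemma ae_ne_zero : ∀ᵐ x : Space N, x ≠ 0 := Measure.ae_ne volume (0 : Space N)

/-- The divergence of the radial field `b(|x|) x`, tested weakly. -/
lemma IsWeakGradient.integral_radial {u : Space N → ℝ} {G : Space N → Space N}
    (h : IsWeakGradient u G) (hu : LocallyIntegrable u) (hG : LocallyIntegrable G)
    {b : ℝ → ℝ} (hb : IsRadialTest b) :
    ∫ x, u x * (N * b ‖x‖ + deriv b ‖x‖ * ‖x‖) = -∫ x, inner ℝ (G x) x * b ‖x‖ := by
  set e : Fin N → Space N := fun i => EuclideanSpace.single i 1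
  have hcoord : ∀ i (x : Space N), inner ℝ x (e i) = x i := fun i x => by
    simp [e, EuclideanSpace.inner_single_right]
  -- These are the components of the field; testing the `i`-th in direction `e i` and summing
  -- produces its divergence.
  set ψ : Fin N → Space N → ℝ := fun i x => b ‖x‖ * x i with hψ
  have hψt : ∀ i, IsTest (ψ i) := fun i =>
    ⟨hb.contDiff_norm.mul (contDiff_euclidean.1 contDiff_id i), hb.hasCompactSupport_norm.mul_right⟩
  have hder : ∀ i (x : Space N), x ≠ 0 →
      fderiv ℝ (ψ i) x (e i) = b ‖x‖ + deriv b ‖x‖ / ‖x‖ * (x i * x i) := by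
    intro i x hx
    have hbd : HasDerivAt b (deriv b ‖x‖) ‖x‖ :=
      (hb.smooth.differentiable (by simp)).differentiableAt.hasDerivAt
    have h1 := (hasGradientAt_comp_norm hx hbd).hasFDerivAt
    have h2 : HasFDerivAt (fun x : Space N => x i) (EuclideanSpace.proj i : Space N →L[ℝ] ℝ) x :=
      (EuclideanSpace.proj i : Space N →L[ℝ] ℝ).hasFDerivAt
    have h5 : HasFDerivAt (ψ i) _ x := h1.mul h2
    rw [h5.fderiv]
    have h3 : (e i) i = 1 := by simp [e]
    have h4 := hcoord i x
    have h6 : (EuclideanSpace.proj i : Space N →L[ℝ] ℝ) (e i) = 1 := h3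
    simp only [add_apply, smul_apply, InnerProductSpace.toDual_apply_apply, inner_smul_left, h4,
      h6, smul_eq_mul, conj_trivial]
    ring
  have hI : ∀ i, Integrable fun x => u x * fderiv ℝ (ψ i) x (e i) := fun i =>
    hu.integrable_smul_right_of_hasCompactSupport ((hψt i).continuous_fderiv_apply _)
      ((hψt i).hasCompactSupport_fderiv_apply _)
  have hGi : ∀ i, LocallyIntegrable fun x => (inner ℝ (G x) (e i) : ℝ) := fun i x => by
    obtain ⟨s, hs, hi⟩ := hG x
    exact ⟨s, hs, hi.inner_const (e i)⟩
  have hI' : ∀ i, Integrable fun x => inner ℝ (G x) (e i) * ψ i x := fun i =>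
    (hGi i).integrable_smul_right_of_hasCompactSupport (hψt i).1.continuous (hψt i).2
  have hsum : ∑ i, ∫ x, u x * fderiv ℝ (ψ i) x (e i) =
      ∑ i, -∫ x, inner ℝ (G x) (e i) * ψ i x :=
    Finset.sum_congr rfl fun i _ => h (ψ i) (hψt i) (e i)
  rw [← integral_finsetSum _ fun i _ => hI i, Finset.sum_neg_distrib,
    ← integral_finsetSum _ fun i _ => hI' i] at hsum
  convert hsum using 1
  · refine integral_congr_ae ?_
    filter_upwards [ae_ne_zero (N := N)] with x hx
    have hn : ‖x‖ ≠ 0 := norm_ne_zero_iff.2 hx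
    have hsq : ∑ i, x i * x i = ‖x‖ ^ 2 := by
      rw [EuclideanSpace.real_norm_sq_eq]; simp [sq]
    rw [← Finset.mul_sum, Finset.sum_congr rfl fun i _ => hder i x hx, Finset.sum_add_distrib,
      ← Finset.mul_sum, hsq]
    simp only [Finset.sum_const, Finset.card_univ, Fintype.card_fin, nsmul_eq_mul]
    field_simp
  · congr 2
    funext x
    have : (inner ℝ (G x) x : ℝ) = ∑ i, inner ℝ (G x) (e i) * x i := by
      simp_rw [hcoord, PiLp.inner_apply]
      simp [mul_comm]
    rw [this, Finset.sum_mul]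
    refine Finset.sum_congr rfl fun i _ => ?_
    rw [hψ]; ring

lemma volume_unit_ball_pos : 0 < (N : ℝ) * volume.real (Metric.ball (0 : Space N) 1) := by
  have h1 : 0 < Module.finrank ℝ (Space N) := Module.finrank_pos
  rw [finrank_euclideanSpace_fin] at h1
  have h2 : 0 < volume.real (Metric.ball (0 : Space N) 1) :=
    ENNReal.toReal_pos (Metric.measure_ball_pos volume 0 one_pos).ne' measure_ball_lt_top.ne
  positivity

lemma integral_norm (f : ℝ → ℝ) : ∫ x : Space N, f ‖x‖ =
    N * volume.real (Metric.ball (0 : Space N) 1) *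
      ∫ r in Set.Ioi (0 : ℝ), r ^ (N - 1) * f r := by
  rw [integral_fun_norm_addHaar, finrank_euclideanSpace_fin, nsmul_eq_mul, smul_eq_mul, mul_assoc]
  rfl

/-- A radial function with a weak gradient has a weakly differentiable profile. -/
lemma IsWeakGradient.exists_profile_weak_deriv {f : ℝ → ℝ} {u : Space N → ℝ}
    {G : Space N → Space N} (h : IsWeakGradient u G) (hu : LocallyIntegrable u)
    (hG : LocallyIntegrable G) (hf : ∀ᵐ x, u x = f ‖x‖) :
    ∃ d : ℝ → ℝ, LocallyIntegrableOn d (Set.Ioi 0) ∧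
      ∀ η, IsRadialTest η → ∫ r, f r * deriv η r = -∫ r, d r * η r := by
  have hg : LocallyIntegrable fun x => (inner ℝ (G x) x : ℝ) := by
    intro x
    obtain ⟨s, hs, hi⟩ := hG x
    refine ⟨s ∩ Metric.closedBall x 1, inter_mem hs (Metric.closedBall_mem_nhds x one_pos), ?_⟩
    have hi' := hi.mono_set (Set.inter_subset_left (t := Metric.closedBall x 1))
    refine Integrable.mono' (hi'.norm.mul_const (‖x‖ + 1))
      (hi'.aestronglyMeasurable.inner aestronglyMeasurable_id) ?_
    have : ∀ᵐ y ∂(volume.restrict (s ∩ Metric.closedBall x 1)), y ∈ Metric.closedBall x 1 :=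
      ae_mono (Measure.restrict_mono Set.inter_subset_right le_rfl)
        (ae_restrict_mem Metric.isClosed_closedBall.measurableSet)
    filter_upwards [this] with y hy
    refine (norm_inner_le_norm _ _).trans ?_
    gcongr
    have h1 : dist y x ≤ 1 := hy
    have h2 := norm_le_norm_add_norm_sub' y x
    rw [dist_eq_norm] at h1
    linarith
  obtain ⟨k, hk, hk'⟩ := exists_radial_density volume hg
  set c := (N : ℝ) * volume.real (Metric.ball (0 : Space N) 1) with hc
  have hc0 : 0 < c := volume_unit_ball_pos
  -- The field `η(|x|) |x|^{-N} x` has divergence `η'(|x|) |x|^{1-N}`, in which the Jacobian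
  -- `r^{N-1}` cancels. The constant `c` is the area of the unit sphere.
  refine ⟨fun r => c⁻¹ * (k r * (r ^ N)⁻¹), ?_, fun η hη => ?_⟩
  · refine locallyIntegrableOn_Ioi_of_Icc fun α β hα => ?_
    refine Integrable.const_mul ?_ _
    exact (hk.integrableOn_compact_subset (fun r hr => hα.trans_le hr.1)
      isCompact_Icc).mul_continuousOn ((continuousOn_pow N).inv₀ fun r hr =>
        (pow_pos (hα.trans_le hr.1) _).ne') isCompact_Icc
  · have hb : IsRadialTest fun r => η r * (r ^ N)⁻¹ :=
      hη.mul_contDiffOn ((contDiff_id.pow N).contDiffOn.inv fun r hr => (pow_pos hr _).ne')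
    have hmain := h.integral_radial hu hG hb
    rw [hk' _ hb] at hmain
    have e1 : ∫ x, u x * (N * (η ‖x‖ * (‖x‖ ^ N)⁻¹) +
        deriv (fun r => η r * (r ^ N)⁻¹) ‖x‖ * ‖x‖) = c * ∫ r, f r * deriv η r := by
      have : ∫ x, u x * (N * (η ‖x‖ * (‖x‖ ^ N)⁻¹) +
        deriv (fun r => η r * (r ^ N)⁻¹) ‖x‖ * ‖x‖) = ∫ x : Space N, (fun r => f r *
          (N * (η r * (r ^ N)⁻¹) + deriv (fun r => η r * (r ^ N)⁻¹) r * r)) ‖x‖ := by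
        refine integral_congr_ae ?_
        filter_upwards [hf] with x hx
        rw [hx]
      rw [this, integral_norm fun r => f r *
          (N * (η r * (r ^ N)⁻¹) + deriv (fun r => η r * (r ^ N)⁻¹) r * r), ← hc]
      congr 1
      rw [← setIntegral_eq_integral_of_forall_compl_eq_zero (s := Set.Ioi (0 : ℝ))
        (f := fun r => f r * deriv η r)]
      · refine setIntegral_congr_fun measurableSet_Ioi fun r hr => ?_
        have hr : 0 < r := hr
        have hd : HasDerivAt η (deriv η r) r :=
          (hη.smooth.differentiable (by simp)).differentiableAt.hasDerivAt
        have hN : N ≠ 0 := by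
          rintro rfl
          simp at hc
          linarith
        have := (hd.mul ((hasDerivAt_pow N r).inv (pow_pos hr N).ne')).deriv
        have hder : deriv (fun r => η r * (r ^ N)⁻¹) r =
          deriv η r * (r ^ N)⁻¹ + η r * (-(N * r ^ (N - 1)) / (r ^ N) ^ 2) := this
        have hp : r ^ N = r ^ (N - 1) * r := by
          rw [← pow_succ, Nat.sub_add_cancel (Nat.one_le_iff_ne_zero.2 hN)]
        rw [hder, hp]
        have : r ^ (N - 1) ≠ 0 := (pow_pos hr _).ne'
        field_simp
        ring
      · intro r hr
        rw [image_eq_zero_of_notMem_tsupport fun h => hr (hη.deriv_isRadialTest.subset h),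
          mul_zero]
    have e2 : ∫ r, c⁻¹ * (k r * (r ^ N)⁻¹) * η r = c⁻¹ * ∫ r, k r * (η r * (r ^ N)⁻¹) := by
      rw [← integral_const_mul]
      congr 1; funext r; ring
    rw [e1] at hmain
    rw [e2, eq_neg_iff_add_eq_zero]
    refine mul_left_cancel₀ hc0.ne' ?_
    rw [mul_add, hmain, mul_inv_cancel_left₀ hc0.ne']
    ring

end WeakGradient

end HardySobolev

/-! ### The weak gradient of a radial function is radial. -/

namespace HardySobolev

variable {N : ℕ}

lemma exists_annulus_of_tsupport {ψ : Space N → ℝ} (hc : HasCompactSupport ψ)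
    (hs : tsupport ψ ⊆ {0}ᶜ) :
    ∃ α β : ℝ, 0 < α ∧ α < 1 ∧ 1 < β ∧ ∀ x, ‖x‖ ∉ Set.Icc α β → x ∉ tsupport ψ := by
  have hK : IsCompact (insert 1 (norm '' tsupport ψ)) :=
    (hc.isCompact.image continuous_norm).insert 1
  obtain ⟨a, ha, ha'⟩ := hK.exists_isLeast ⟨1, Set.mem_insert _ _⟩
  obtain ⟨b, hb, hb'⟩ := hK.exists_isGreatest ⟨1, Set.mem_insert _ _⟩
  have ha0 : 0 < a := by
    rcases ha with rfl | ⟨x, hx, rfl⟩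
    · exact one_pos
    · exact norm_pos_iff.2 (hs hx)
  have ha1 : a ≤ 1 := ha' (Set.mem_insert _ _)
  have hb1 : 1 ≤ b := hb' (Set.mem_insert _ _)
  refine ⟨a / 2, b + 1, by linarith, by linarith, by linarith, fun x hx hmem => hx ?_⟩
  have hmem : ‖x‖ ∈ insert 1 (norm '' tsupport ψ) := Or.inr ⟨x, hmem, rfl⟩
  exact ⟨by linarith [ha' hmem], by linarith [hb' hmem]⟩

lemma abs_primitive_sub_le {b g : ℝ → ℝ} {α β ε : ℝ} (hb : LocallyIntegrableOn b (Set.Ioi 0))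
    (hα : 0 < α) (hα1 : α < 1) (hβ : 1 < β) (hgi : Integrable g)
    (hε : ∫ r, ‖(Set.Icc α β).indicator b r - g r‖ ≤ ε) {r : ℝ} (hr : r ∈ Set.Icc α β) :
    |(∫ t in (1 : ℝ)..r, b t) - ∫ t in (1 : ℝ)..r, g t| ≤ ε := by
  have hI := intervalIntegrable_of_pos hb one_pos (hα.trans_le hr.1)
  have hki : Integrable ((Set.Icc α β).indicator b) :=
    (hb.integrableOn_compact_subset (fun r hr => hα.trans_le hr.1)
      isCompact_Icc).integrable_indicator measurableSet_Icc
  have e : ∫ t in (1 : ℝ)..r, b t = ∫ t in (1 : ℝ)..r, (Set.Icc α β).indicator b t := by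
    refine intervalIntegral.integral_congr fun t ht => ?_
    have : t ∈ Set.Icc α β := Set.uIcc_subset_Icc ⟨hα1.le, hβ.le⟩ hr ht
    rw [Set.indicator_of_mem this]
  rw [e, ← intervalIntegral.integral_sub hki.intervalIntegrable hgi.intervalIntegrable]
  rw [← Real.norm_eq_abs]
  refine (intervalIntegral.norm_integral_le_integral_norm_uIoc).trans (le_trans ?_ hε)
  exact setIntegral_le_integral (hki.sub hgi).norm (Eventually.of_forall fun _ => norm_nonneg _)

variable [Nontrivial (Space N)]

lemma integral_abs_annulus_le {k : ℝ → ℝ} {α β : ℝ} (hα : 0 < α) (hβ : 0 < β)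
    (hk : Integrable k) :
    ∫ x : Space N, |(Set.Icc α β).indicator k ‖x‖| ≤
      N * volume.real (Metric.ball (0 : Space N) 1) * (β ^ (N - 1) * ∫ r, |k r|) := by
  rw [integral_norm fun r => |(Set.Icc α β).indicator k r|]
  refine mul_le_mul_of_nonneg_left ?_ volume_unit_ball_pos.le
  rw [← integral_const_mul, ← integral_indicator measurableSet_Ioi]
  refine integral_mono_of_nonneg (Eventually.of_forall fun r => ?_) (hk.abs.const_mul _)
    (Eventually.of_forall fun r => ?_)
  · have h0 : ∀ r ∈ Set.Ioi (0 : ℝ), 0 ≤ r ^ (N - 1) * |(Set.Icc α β).indicator k r| :=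
      fun r hr => mul_nonneg (pow_nonneg (le_of_lt hr) _) (abs_nonneg _)
    exact Set.indicator_nonneg h0 r
  · have h0 : 0 ≤ β ^ (N - 1) * |k r| := by positivity
    by_cases hr : r ∈ Set.Icc α β
    · have hr0 : 0 < r := hα.trans_le hr.1
      simp only [Set.indicator_of_mem (Set.mem_Ioi.2 hr0), Set.indicator_of_mem hr]
      gcongr
      exact hr.2
    · simp only [Set.indicator, hr, if_false, abs_zero, mul_zero, ite_self]
      exact h0

/-- The radial function `F(|x|)` with `F' = b` has the weak gradient `b(|x|) x / |x|` away from
the origin. -/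
lemma weak_gradient_primitive {b : ℝ → ℝ} (hb : LocallyIntegrableOn b (Set.Ioi 0)) (c : ℝ)
    {ψ : Space N → ℝ} (hψ : IsTest ψ) (hs : tsupport ψ ⊆ {0}ᶜ) (v : Space N) :
    ∫ x, (c + ∫ t in (1 : ℝ)..‖x‖, b t) * fderiv ℝ ψ x v =
      -∫ x, inner ℝ ((b ‖x‖ / ‖x‖) • x) v * ψ x := by
  obtain ⟨α, β, hα, hα1, hβ, hann⟩ := exists_annulus_of_tsupport hψ.2 hs
  set D : Space N → ℝ := fun x => fderiv ℝ ψ x v with hD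
  have hDc : Continuous D := hψ.continuous_fderiv_apply v
  have hDs : HasCompactSupport D := hψ.hasCompactSupport_fderiv_apply v
  have hDt : tsupport D ⊆ tsupport ψ :=
    (tsupport_comp_subset (g := fun L : Space N →L[ℝ] ℝ => L v) rfl _).trans
      (tsupport_fderiv_subset ℝ)
  have hDi : Integrable D := hDc.integrable_of_hasCompactSupport hDs
  set wt : Space N → ℝ := fun x => inner ℝ x v / ‖x‖ * ψ x with hwt
  have hwtm : Measurable wt := by
    have : Measurable ψ := hψ.1.continuous.measurable
    fun_prop
  obtain ⟨Mψ, hMψ⟩ := hψ.2.exists_bound_of_continuous hψ.1.continuous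
  have hMψ0 : 0 ≤ Mψ := (norm_nonneg _).trans (hMψ 0)
  set M := ‖v‖ * Mψ with hM
  have hM0 : 0 ≤ M := by positivity
  have hwtb : ∀ x, |wt x| ≤ M := by
    intro x
    rw [hwt, abs_mul]
    refine mul_le_mul ?_ (hMψ x) (abs_nonneg _) (norm_nonneg _)
    rw [abs_div, abs_norm]
    refine div_le_of_le_mul₀ (norm_nonneg _) (norm_nonneg _) ?_
    rw [mul_comm]
    exact abs_real_inner_le_norm x v
  have hwt0 : ∀ x, ‖x‖ ∉ Set.Icc α β → wt x = 0 := fun x hx => by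
    rw [hwt]; simp only
    rw [image_eq_zero_of_notMem_tsupport (hann x hx), mul_zero]
  have hD0 : ∀ x, ‖x‖ ∉ Set.Icc α β → D x = 0 := fun x hx =>
    image_eq_zero_of_notMem_tsupport fun h => hann x hx (hDt h)
  have hF : ∀ b : ℝ → ℝ, LocallyIntegrableOn b (Set.Ioi 0) →
      Integrable fun x : Space N => (c + ∫ t in (1 : ℝ)..‖x‖, b t) * D x := fun b hb => by
    refine integrable_mul_of_tsupport_subset (U := {0}ᶜ) ?_ hDc hDs (hDt.trans hs)
    refine locallyIntegrableOn_norm volume (f := fun r => c + ∫ t in (1 : ℝ)..r, b t) ?_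
    exact (continuousOn_const.add (continuousOn_primitive hb)).locallyIntegrableOn
      measurableSet_Ioi
  have hW : ∀ k : ℝ → ℝ, LocallyIntegrableOn k (Set.Ioi 0) →
      Integrable fun x : Space N => k ‖x‖ * wt x := fun k hk => by
    have h1 : Integrable fun x : Space N => (Set.Icc α β).indicator k ‖x‖ * wt x :=
      (integrable_annulus volume hk hα).mul_bdd (c := M) hwtm.aestronglyMeasurable
        (Eventually.of_forall hwtb)
    refine h1.congr (Eventually.of_forall fun x => ?_)
    by_cases hx : ‖x‖ ∈ Set.Icc α β
    · simp only [Set.indicator_of_mem hx]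
    · simp only [hwt0 x hx, mul_zero]
  have hswap : ∀ (k : ℝ → ℝ) (x : Space N),
      inner ℝ ((k ‖x‖ / ‖x‖) • x) v * ψ x = k ‖x‖ * wt x := fun k x => by
    rw [real_inner_smul_left, hwt]; ring
  simp_rw [hswap b]
  set K := (∫ x, |D x|) + M * (N * volume.real (Metric.ball (0 : Space N) 1) * β ^ (N - 1))
    with hKdef
  have hK : 0 ≤ K := by
    have h1 : 0 ≤ ∫ x, |D x| := integral_nonneg fun _ => abs_nonneg _
    have h2 := (volume_unit_ball_pos (N := N)).le
    have h3 : (0 : ℝ) ≤ β ^ (N - 1) := by positivity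
    positivity
  have hki : Integrable ((Set.Icc α β).indicator b) :=
    (hb.integrableOn_compact_subset (fun r hr => hα.trans_le hr.1)
      isCompact_Icc).integrable_indicator measurableSet_Icc
  have hsmall : ∀ ε, 0 < ε → |(∫ x, (c + ∫ t in (1 : ℝ)..‖x‖, b t) * D x) +
      ∫ x, b ‖x‖ * wt x| ≤ K * ε := by
    intro ε hε
    -- Approximate `b` in `L¹` on the annulus by a continuous `g`, for which the primitive is
    -- differentiable and the identity is classical. The primitives are then uniformly close there,
    -- so the defect for `b` is at most `K * ε`.
    obtain ⟨g, -, hgε, hgc, hgi⟩ := hki.exists_hasCompactSupport_integral_sub_le hε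
    have hgl : LocallyIntegrableOn g (Set.Ioi 0) := hgc.locallyIntegrable.locallyIntegrableOn _
    have hprim : ∀ r, HasDerivAt (fun r => c + ∫ t in (1 : ℝ)..r, g t) (g r) r := fun r =>
      (intervalIntegral.integral_hasDerivAt_right (hgc.intervalIntegrable _ _)
        hgc.stronglyMeasurable.stronglyMeasurableAtFilter hgc.continuousAt).const_add c
    have hgrad : ∀ x : Space N, x ≠ 0 → HasFDerivAt
        (fun x : Space N => c + ∫ t in (1 : ℝ)..‖x‖, g t)
        (InnerProductSpace.toDual ℝ (Space N) ((g ‖x‖ / ‖x‖) • x)) x := fun x hx =>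
      (hasGradientAt_comp_norm hx (hprim ‖x‖)).hasFDerivAt
    have hfd : ∀ x : Space N, x ≠ 0 →
        fderiv ℝ (fun x : Space N => c + ∫ t in (1 : ℝ)..‖x‖, g t) x v * ψ x =
          g ‖x‖ * wt x := fun x hx => by
      rw [(hgrad x hx).fderiv, InnerProductSpace.toDual_apply_apply, hswap]
    have hae : (fun x : Space N =>
        fderiv ℝ (fun x : Space N => c + ∫ t in (1 : ℝ)..‖x‖, g t) x v * ψ x) =ᵐ[volume]
        fun x => g ‖x‖ * wt x := by
      filter_upwards [ae_ne_zero (N := N)] with x hx using hfd x hx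
    have hprimc : Continuous fun x : Space N => c + ∫ t in (1 : ℝ)..‖x‖, g t :=
      (continuous_iff_continuousAt.2 fun r => (hprim r).continuousAt).comp continuous_norm
    have hibp : ∫ x, (c + ∫ t in (1 : ℝ)..‖x‖, g t) * D x = -∫ x, g ‖x‖ * wt x := by
      rw [← integral_congr_ae hae]
      refine integral_mul_fderiv_eq_neg_fderiv_mul_of_integrable ?_ (hF g hgl) ?_
        (fun x hx => (hgrad x (hs hx)).differentiableAt)
        (fun x _ => (hψ.1.differentiable (by simp)).differentiableAt)
      · exact (hW g hgl).congr hae.symm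
      · exact (hprimc.mul hψ.1.continuous).integrable_of_hasCompactSupport hψ.2.mul_left
    have h1 : |(∫ x, (c + ∫ t in (1 : ℝ)..‖x‖, b t) * D x) -
        ∫ x, (c + ∫ t in (1 : ℝ)..‖x‖, g t) * D x| ≤ (∫ x, |D x|) * ε := by
      rw [← integral_sub (hF b hb) (hF g hgl), ← integral_mul_const, ← Real.norm_eq_abs]
      refine norm_integral_le_of_norm_le (hDi.abs.mul_const ε) (Eventually.of_forall fun x => ?_)
      rw [← sub_mul, norm_mul, Real.norm_eq_abs, Real.norm_eq_abs, mul_comm]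
      by_cases hx : ‖x‖ ∈ Set.Icc α β
      · gcongr
        rw [add_sub_add_left_eq_sub]
        exact abs_primitive_sub_le hb hα hα1 hβ hgi hgε hx
      · rw [hD0 x hx]; simp
    have h2 : |(∫ x, b ‖x‖ * wt x) - ∫ x, g ‖x‖ * wt x| ≤
        M * (N * volume.real (Metric.ball (0 : Space N) 1) * β ^ (N - 1)) * ε := by
      rw [← integral_sub (hW b hb) (hW g hgl), ← Real.norm_eq_abs]
      set k : ℝ → ℝ := fun r => (Set.Icc α β).indicator b r - g r with hk
      have hkint : Integrable k := hki.sub hgi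
      have h3 := integral_abs_annulus_le (N := N) hα (zero_lt_one.trans hβ) hkint
      have h4 : Integrable fun x : Space N => |(Set.Icc α β).indicator k ‖x‖| :=
        (integrable_annulus volume (hkint.locallyIntegrable.locallyIntegrableOn _) hα).abs
      refine (norm_integral_le_of_norm_le (h4.const_mul M)
        (Eventually.of_forall fun x => ?_)).trans ?_
      · rw [← sub_mul, norm_mul, Real.norm_eq_abs, Real.norm_eq_abs, mul_comm]
        by_cases hx : ‖x‖ ∈ Set.Icc α β
        · rw [Set.indicator_of_mem hx, hk]
          simp only [Set.indicator_of_mem hx]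
          gcongr
          exact hwtb x
        · rw [hwt0 x hx]
          simp only [abs_zero, zero_mul]
          positivity
      · rw [integral_const_mul, mul_assoc M]
        refine mul_le_mul_of_nonneg_left (h3.trans ?_) hM0
        rw [mul_assoc _ (β ^ (N - 1)) ε]
        refine mul_le_mul_of_nonneg_left ?_ volume_unit_ball_pos.le
        gcongr
        exact hgε
    rw [hibp] at h1
    have h5 := abs_add_le ((∫ x, (c + ∫ t in (1 : ℝ)..‖x‖, b t) * D x) - -∫ x, g ‖x‖ * wt x)
      ((∫ x, b ‖x‖ * wt x) - ∫ x, g ‖x‖ * wt x)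
    have h6 : (∫ x, (c + ∫ t in (1 : ℝ)..‖x‖, b t) * D x) - (-∫ x, g ‖x‖ * wt x) +
      ((∫ x, b ‖x‖ * wt x) - ∫ x, g ‖x‖ * wt x) =
      (∫ x, (c + ∫ t in (1 : ℝ)..‖x‖, b t) * D x) + ∫ x, b ‖x‖ * wt x := by ring
    rw [h6] at h5
    rw [hKdef, add_mul]
    linarith
  have hz : |(∫ x, (c + ∫ t in (1 : ℝ)..‖x‖, b t) * D x) + ∫ x, b ‖x‖ * wt x| ≤ 0 := by
    refine le_of_forall_pos_le_add fun ε hε => ?_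
    have h1 := hsmall (ε / (K + 1)) (by positivity)
    have h2 : K * (ε / (K + 1)) ≤ ε := by
      rw [mul_div_assoc', div_le_iff₀ (by positivity)]
      nlinarith
    linarith
  have := abs_eq_zero.1 (le_antisymm hz (abs_nonneg _))
  linarith

/-- A weak gradient of a radial function is radial. -/
lemma IsWeakGradient.eq_radial {u : Space N → ℝ} {G : Space N → Space N}
    (h : IsWeakGradient u G) (hG : LocallyIntegrable G) {b : ℝ → ℝ}
    (hb : LocallyIntegrableOn b (Set.Ioi 0)) {c : ℝ}
    (hu : ∀ᵐ x, u x = c + ∫ t in (1 : ℝ)..‖x‖, b t) :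
    ∀ᵐ x, G x = (b ‖x‖ / ‖x‖) • x := by
  have hbl : LocallyIntegrableOn (fun x : Space N => (b ‖x‖ / ‖x‖) • x) {0}ᶜ := by
    have h1 : LocallyIntegrableOn (fun x : Space N => b ‖x‖) {0}ᶜ := locallyIntegrableOn_norm _ hb
    intro x hx
    obtain ⟨s, hs, hi⟩ := h1 x hx
    obtain ⟨t, hts, hi⟩ : ∃ t ∈ 𝓝[{0}ᶜ] x, IntegrableOn (fun x : Space N => b ‖x‖) t ∧
        MeasurableSet t := by
      obtain ⟨o, ho, hxo, hos⟩ := mem_nhdsWithin.1 hs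
      exact ⟨o ∩ {0}ᶜ, inter_mem (mem_nhdsWithin_of_mem_nhds (ho.mem_nhds hxo))
        self_mem_nhdsWithin, hi.mono_set hos, ho.measurableSet.inter
          (measurableSet_singleton _).compl⟩
    refine ⟨t, hts, Integrable.mono' hi.1.norm ?_ (Eventually.of_forall fun y => ?_)⟩
    · have hm : Measurable fun x : Space N => ‖x‖⁻¹ • x := by fun_prop
      refine (hi.1.aestronglyMeasurable.smul hm.aestronglyMeasurable).congr
        (Eventually.of_forall fun y => ?_)
      simp [smul_smul, div_eq_mul_inv]
    · rw [norm_smul, norm_div, norm_norm]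
      rcases eq_or_ne ‖y‖ 0 with h0 | h0
      · rw [h0]; simp
      · rw [div_mul_cancel₀ _ h0]
  have hW : LocallyIntegrableOn (fun x => G x - (b ‖x‖ / ‖x‖) • x) {0}ᶜ :=
    (hG.locallyIntegrableOn _).sub hbl
  have hint : ∀ (A : Space N → Space N), LocallyIntegrableOn A {0}ᶜ → ∀ ψ : Space N → ℝ,
      IsTest ψ → tsupport ψ ⊆ {0}ᶜ → Integrable fun x => ψ x • A x := by
    intro A hA ψ hψ hs
    have h1 : IntegrableOn (fun x => ψ x • A x) (tsupport ψ) :=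
      (hA.integrableOn_compact_subset hs hψ.2).continuousOn_smul hψ.1.continuous.continuousOn hψ.2
    refine (integrableOn_iff_integrable_of_support_subset ?_).1 h1
    intro x hx
    refine subset_tsupport ψ fun h0 => hx ?_
    simp [h0]
  have hU : IsOpen ({0}ᶜ : Set (Space N)) := isOpen_compl_singleton
  -- Both fields are weak gradients of `u` away from the origin; their difference is annihilated by
  -- all test functions there.
  have key := hU.ae_eq_zero_of_integral_contDiff_smul_eq_zero hW fun ψ hψs hψc hψt => by
      have hψ : IsTest ψ := ⟨hψs, hψc⟩
      have i1 := hint _ (hG.locallyIntegrableOn _) ψ hψ hψt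
      have i2 := hint _ hbl ψ hψ hψt
      simp_rw [smul_sub]
      rw [integral_sub i1 i2, sub_eq_zero]
      refine ext_inner_left ℝ fun v => ?_
      rw [← integral_inner i1, ← integral_inner i2]
      have e1 := h ψ hψ v
      have e2 := weak_gradient_primitive hb c hψ hψt v
      have e3 : ∫ x, u x * fderiv ℝ ψ x v =
          ∫ x, (c + ∫ t in (1 : ℝ)..‖x‖, b t) * fderiv ℝ ψ x v := by
        refine integral_congr_ae ?_
        filter_upwards [hu] with x hx
        rw [hx]
      rw [e1, e2] at e3
      have e4 := neg_injective e3
      have e5 : ∀ A : Space N → Space N, ∀ x, (inner ℝ v (ψ x • A x) : ℝ) = inner ℝ (A x) v * ψ x :=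
        fun A x => by rw [inner_smul_right, real_inner_comm, mul_comm]
      rw [integral_congr_ae (Eventually.of_forall (e5 G)), e4]
      exact (integral_congr_ae (Eventually.of_forall
        (e5 fun x => (b ‖x‖ / ‖x‖) • x))).symm
  filter_upwards [key, ae_ne_zero (N := N)] with x hx hx0
  exact sub_eq_zero.1 (hx hx0)

end HardySobolev

/-! ### Regularity: from weak radial solutions to classical profiles. -/

namespace HardySobolev

lemma hasDerivAt_primitive {g : ℝ → ℝ} (hg : ContinuousOn g (Set.Ioi 0)) {r : ℝ} (hr : 0 < r) :
    HasDerivAt (fun r => ∫ t in (1 : ℝ)..r, g t) (g r) r :=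
  intervalIntegral.integral_hasDerivAt_right
    (intervalIntegrable_of_pos (hg.locallyIntegrableOn measurableSet_Ioi) one_pos hr)
    (hg.stronglyMeasurableAtFilter isOpen_Ioi r hr) (hg.continuousAt (isOpen_Ioi.mem_nhds hr))

variable {N : ℕ} {p μ s : ℝ} {u : Space N → ℝ}

/-- Pointwise `|d|^(p-1) ≤ 1 + |d|^p`. -/
lemma locallyIntegrableOn_pow_mul_dpow (hp : 1 < p) {d : ℝ → ℝ}
    (hd : LocallyIntegrableOn d (Set.Ioi 0))
    (hE : IntegrableOn (fun r => r ^ (N - 1) * |d r| ^ p) (Set.Ioi 0)) :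
    LocallyIntegrableOn (fun r => r ^ (N - 1) * dpow p (d r)) (Set.Ioi 0) := by
  refine locallyIntegrableOn_Ioi_of_Icc fun α β hα => ?_
  have hsub : Set.Icc α β ⊆ Set.Ioi 0 := fun r hr => hα.trans_le hr.1
  have hdi := hd.integrableOn_compact_subset hsub isCompact_Icc
  have hpow : IntegrableOn (fun r : ℝ => r ^ (N - 1)) (Set.Icc α β) :=
    (continuousOn_pow _).integrableOn_Icc
  refine Integrable.mono' (hpow.add (hE.mono_set hsub)) ?_ ?_
  · exact (continuousOn_pow _).aestronglyMeasurable measurableSet_Icc |>.mul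
      ((continuous_dpow hp).comp_aestronglyMeasurable hdi.aestronglyMeasurable)
  · filter_upwards [ae_restrict_mem measurableSet_Icc] with r hr
    have hr0 : 0 ≤ r ^ (N - 1) := pow_nonneg (hsub hr).le _
    rw [norm_mul, Real.norm_of_nonneg hr0, Real.norm_eq_abs, abs_dpow hp, Pi.add_apply,
      ← mul_one_add]
    refine mul_le_mul_of_nonneg_left ?_ hr0
    rcases le_total |d r| 1 with h | h
    · have := Real.rpow_le_one (abs_nonneg (d r)) h (show 0 ≤ p - 1 by linarith)
      have : 0 ≤ |d r| ^ p := by positivity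
      linarith
    · have := Real.rpow_le_rpow_of_exponent_le h (show p - 1 ≤ p by linarith)
      linarith

variable [Nontrivial (Space N)]

lemma integrableOn_of_norm {g : ℝ → ℝ} (h : Integrable fun x : Space N => g ‖x‖) :
    IntegrableOn (fun r => r ^ (N - 1) * g r) (Set.Ioi 0) := by
  rw [integrable_fun_norm_addHaar, finrank_euclideanSpace_fin] at h
  exact h

/-- The weak form of the radial equation. -/
lemma weak_radial_equation (hp : 1 < p) (hq : 1 < critExp N p s) {G : Space N → Space N}
    (hweak : ∀ φ : Space N → ℝ, IsTest φ →
      ∫ x, (‖G x‖ ^ (p - 2) * inner ℝ (G x) (gradient φ x)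
          - μ / ‖x‖ ^ p * (|u x| ^ (p - 2) * u x) * φ x) =
        ∫ x, |u x| ^ (critExp N p s - 2) * u x / ‖x‖ ^ s * φ x)
    {F d : ℝ → ℝ} (hu : ∀ᵐ x, u x = F ‖x‖) (hG : ∀ᵐ x, G x = (d ‖x‖ / ‖x‖) • x)
    (hF : ContinuousOn F (Set.Ioi 0))
    (ha : LocallyIntegrableOn (fun r => r ^ (N - 1) * dpow p (d r)) (Set.Ioi 0)) :
    ContinuousOn (fun r => -(r ^ (N - 1) *
      (μ / r ^ p * dpow p (F r) + dpow (critExp N p s) (F r) / r ^ s))) (Set.Ioi 0) ∧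
    ∀ η, IsRadialTest η → ∫ r, r ^ (N - 1) * dpow p (d r) * deriv η r =
      -∫ r, -(r ^ (N - 1) *
        (μ / r ^ p * dpow p (F r) + dpow (critExp N p s) (F r) / r ^ s)) * η r := by
  have hrp : ∀ a : ℝ, ContinuousOn (fun r : ℝ => r ^ a) (Set.Ioi 0) := fun a =>
    continuousOn_id.rpow_const fun r hr => Or.inl (ne_of_gt hr)
  have hrp0 : ∀ a : ℝ, ∀ r ∈ Set.Ioi (0 : ℝ), r ^ a ≠ 0 := fun a r hr =>
    (Real.rpow_pos_of_pos hr a).ne'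
  have hB₁ : ContinuousOn (fun r => r ^ (N - 1) * (μ / r ^ p * dpow p (F r))) (Set.Ioi 0) :=
    (continuousOn_pow _).mul ((continuousOn_const.div (hrp p) (hrp0 p)).mul
      ((continuous_dpow hp).comp_continuousOn hF))
  have hB₂ : ContinuousOn (fun r => r ^ (N - 1) * (dpow (critExp N p s) (F r) / r ^ s))
      (Set.Ioi 0) :=
    (continuousOn_pow _).mul (((continuous_dpow hq).comp_continuousOn hF).div (hrp s) (hrp0 s))
  refine ⟨((hB₁.add hB₂).neg).congr fun r _ => by
    simp only [Pi.neg_apply, Pi.add_apply]; ring, fun η hη => ?_⟩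
  have hw := hweak _ hη.isTest_norm
  have hηd : ∀ r, HasDerivAt η (deriv η r) r := fun r =>
    (hη.smooth.differentiable (by simp)).differentiableAt.hasDerivAt
  have e₁ : ∫ x, (‖G x‖ ^ (p - 2) * inner ℝ (G x) (gradient (fun x : Space N => η ‖x‖) x)
      - μ / ‖x‖ ^ p * (|u x| ^ (p - 2) * u x) * η ‖x‖) = ∫ x : Space N, (fun r =>
        dpow p (d r) * deriv η r - μ / r ^ p * dpow p (F r) * η r) ‖x‖ := by
    refine integral_congr_ae ?_
    filter_upwards [hu, hG, ae_ne_zero (N := N)] with x h1 h2 h3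
    have hn : ‖x‖ ≠ 0 := norm_ne_zero_iff.2 h3
    rw [h1, h2, (hasGradientAt_comp_norm h3 (hηd ‖x‖)).gradient, norm_smul, norm_div, norm_norm,
      div_mul_cancel₀ _ hn, real_inner_smul_left, real_inner_smul_right, real_inner_self_eq_norm_sq,
      Real.norm_eq_abs]
    simp only [dpow]
    field_simp
  have e₂ : ∫ x, |u x| ^ (critExp N p s - 2) * u x / ‖x‖ ^ s * η ‖x‖ =
      ∫ x : Space N, (fun r => dpow (critExp N p s) (F r) / r ^ s * η r) ‖x‖ := by
    refine integral_congr_ae ?_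
    filter_upwards [hu] with x h1
    rw [h1]; rfl
  rw [e₁, e₂, integral_norm fun r => dpow p (d r) * deriv η r - μ / r ^ p * dpow p (F r) * η r,
    integral_norm fun r => dpow (critExp N p s) (F r) / r ^ s * η r] at hw
  have hw := mul_left_cancel₀ volume_unit_ball_pos.ne' hw
  have hη0 : ∀ r, r ∉ Set.Ioi (0 : ℝ) → η r = 0 := fun r hr =>
    image_eq_zero_of_notMem_tsupport fun h => hr (hη.subset h)
  have hη0' : ∀ r, r ∉ Set.Ioi (0 : ℝ) → deriv η r = 0 := fun r hr =>
    image_eq_zero_of_notMem_tsupport fun h => hr (hη.deriv_isRadialTest.subset h)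
  rw [setIntegral_eq_integral_of_forall_compl_eq_zero (fun r hr => by
      rw [hη0 r hr, hη0' r hr]; simp),
    setIntegral_eq_integral_of_forall_compl_eq_zero (fun r hr => by
      rw [hη0 r hr]; simp)] at hw
  have i₀ := hη.deriv_isRadialTest.integrable_mul ha
  have i₁ := hη.integrable_mul (hB₁.locallyIntegrableOn measurableSet_Ioi)
  have i₂ := hη.integrable_mul (hB₂.locallyIntegrableOn measurableSet_Ioi)
  have e₃ : (fun r : ℝ => r ^ (N - 1) * (dpow p (d r) * deriv η r -
      μ / r ^ p * dpow p (F r) * η r)) = fun r => r ^ (N - 1) * dpow p (d r) * deriv η r -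
      r ^ (N - 1) * (μ / r ^ p * dpow p (F r)) * η r := by funext r; ring
  have e₄ : (fun r : ℝ => r ^ (N - 1) * (dpow (critExp N p s) (F r) / r ^ s * η r)) =
      fun r => r ^ (N - 1) * (dpow (critExp N p s) (F r) / r ^ s) * η r := by funext r; ring
  have e₅ : (fun r : ℝ => -(r ^ (N - 1) *
        (μ / r ^ p * dpow p (F r) + dpow (critExp N p s) (F r) / r ^ s)) * η r) = fun r =>
      -(r ^ (N - 1) * (μ / r ^ p * dpow p (F r)) * η r +
        r ^ (N - 1) * (dpow (critExp N p s) (F r) / r ^ s) * η r) := by funext r; ring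
  rw [e₃, e₄, integral_sub i₀ i₁] at hw
  rw [e₅, integral_neg, integral_add i₁ i₂, neg_neg]
  linarith

/-- Every positive radial solution has a classical radial profile. -/
theorem IsPosRadialSol.exists_profile (hp : 1 < p) (hpN : p < (N : ℝ)) (hsp : s < p)
    (h : IsPosRadialSol p μ s u) : ∃ F D, IsProfile N p μ s F D ∧ ∀ᵐ x, u x = F ‖x‖ := by
  obtain ⟨⟨G, hmem, hweak⟩, hpos, f, hf⟩ := h
  have hc1 := one_lt_critExp_zero hp hpN
  have hul : LocallyIntegrable u := hmem.1.locallyIntegrable (by simpa using hc1.le)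
  have hGl : LocallyIntegrable G := hmem.2.1.locallyIntegrable (by simpa using hp.le)
  have hwg := hmem.isWeakGradient hp hpN
  have hfl : LocallyIntegrableOn f (Set.Ioi 0) := locallyIntegrableOn_of_norm volume fun x => by
    obtain ⟨t, ht, hi⟩ := hul x
    exact ⟨t, ht, hi.congr (ae_restrict_of_ae hf)⟩
  obtain ⟨d, hd, hfd⟩ := hwg.exists_profile_weak_deriv hul hGl hf
  -- First use of du Bois-Reymond: the profile is a primitive, so it has a continuous representative
  -- `F`.
  obtain ⟨c, hc⟩ := eq_primitive_of_integral_mul_deriv hfl hd hfd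
  set F : ℝ → ℝ := fun r => c + ∫ t in (1 : ℝ)..r, d t with hF
  have hFc : ContinuousOn F (Set.Ioi 0) := continuousOn_const.add (continuousOn_primitive hd)
  have huF : ∀ᵐ x, u x = F ‖x‖ := by
    filter_upwards [hf, ae_norm_of_ae volume hc, ae_ne_zero (N := N)] with x h1 h2 h3
    rw [h1, h2 h3]
  have hGd := hwg.eq_radial hGl hd huF
  have hE : IntegrableOn (fun r => r ^ (N - 1) * |d r| ^ p) (Set.Ioi 0) := by
    refine integrableOn_of_norm (g := fun r => |d r| ^ p) ?_
    have := hmem.2.1.integrable_norm_rpow (by simpa using hp.trans' one_pos) ENNReal.ofReal_ne_top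
    rw [ENNReal.toReal_ofReal (by linarith)] at this
    refine this.congr ?_
    filter_upwards [hGd, ae_ne_zero (N := N)] with x h1 h2
    rw [h1, norm_smul, norm_div, norm_norm, div_mul_cancel₀ _ (norm_ne_zero_iff.2 h2),
      Real.norm_eq_abs]
  have hM : IntegrableOn (fun r => r ^ (N - 1) * |F r| ^ critExp N p 0) (Set.Ioi 0) := by
    refine integrableOn_of_norm (g := fun r => |F r| ^ critExp N p 0) ?_
    have := hmem.1.integrable_norm_rpow (by simpa using hc1.trans' one_pos) ENNReal.ofReal_ne_top
    rw [ENNReal.toReal_ofReal (by linarith)] at this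
    refine this.congr ?_
    filter_upwards [huF] with x h1
    rw [h1, Real.norm_eq_abs]
  have ha := locallyIntegrableOn_pow_mul_dpow hp hd hE
  obtain ⟨hBc, hB⟩ :=
    weak_radial_equation hp (hp.trans (critExp_gt hp hpN hsp)) hweak huF hGd hFc ha
  -- Second use, for the flux: its weak derivative is continuous because `F` is, so the flux has a
  -- continuously differentiable representative `J`. Inverting the odd power gives a continuous `D`
  -- equal to `d` almost everywhere.
  obtain ⟨c', hc'⟩ := eq_primitive_of_integral_mul_deriv ha
    (hBc.locallyIntegrableOn measurableSet_Ioi) hB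
  set B : ℝ → ℝ := fun r => -(r ^ (N - 1) *
    (μ / r ^ p * dpow p (F r) + dpow (critExp N p s) (F r) / r ^ s)) with hBdef
  set J : ℝ → ℝ := fun r => c' + ∫ t in (1 : ℝ)..r, B t with hJ
  have hJd : ∀ r, 0 < r → HasDerivAt J (B r) r := fun r hr =>
    (hasDerivAt_primitive hBc hr).const_add c'
  have hconj : p.HolderConjugate p.conjExponent := .conjExponent hp
  set D : ℝ → ℝ := fun r => dpow p.conjExponent (J r / r ^ (N - 1)) with hD
  have hDJ : ∀ r, 0 < r → r ^ (N - 1) * dpow p (D r) = J r := fun r hr => by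
    have := (pow_pos hr (N - 1)).ne'
    rw [hD]; simp only
    rw [dpow_dpow hconj.symm]
    field_simp
  have hDc : ContinuousOn D (Set.Ioi 0) := by
    refine (continuous_dpow hconj.symm.lt).comp_continuousOn (ContinuousOn.div ?_
      (continuousOn_pow _) fun r hr => (pow_pos hr _).ne')
    exact fun r hr => (hJd r hr).continuousAt.continuousWithinAt
  have hDd : ∀ᵐ r : ℝ, 0 < r → D r = d r := by
    filter_upwards [hc'] with r hr hr0
    have h1 : r ^ (N - 1) * dpow p (d r) = J r := hr hr0
    have := (pow_pos hr0 (N - 1)).ne'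
    rw [hD]; simp only
    rw [← h1, mul_div_cancel_left₀ _ this, dpow_dpow hconj]
  have hFD : ∀ r, 0 < r → F r = c + ∫ t in (1 : ℝ)..r, D t := fun r hr => by
    rw [hF]; simp only
    congr 1
    refine intervalIntegral.integral_congr_ae ?_
    filter_upwards [hDd] with t ht ht'
    refine (ht ?_).symm
    rw [Set.uIoc, Set.mem_Ioc] at ht'
    exact (lt_min one_pos hr).trans ht'.1
  have hpos' : ∀ᵐ x : Space N, 0 < F ‖x‖ := by
    filter_upwards [hpos, huF] with x h1 h2
    rwa [← h2]
  refine ⟨F, D, ⟨fun r hr => ?_, ?_, fun r hr => ?_, fun r hr => ?_, ?_, hM⟩, huF⟩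
  -- Positivity holds only almost everywhere, but a negative value of the continuous `F` would
  -- persist on a set of positive measure.
  · by_contra hneg
    rw [not_le] at hneg
    obtain ⟨x₀, hx₀⟩ := exists_norm_eq (Space N) hr.le
    have h1 : ∀ᶠ x in 𝓝 x₀, F ‖x‖ < 0 := by
      have : ContinuousAt (fun x : Space N => F ‖x‖) x₀ := by
        refine ContinuousAt.comp (g := F) ?_ continuous_norm.continuousAt
        rw [hx₀]
        exact hFc.continuousAt (isOpen_Ioi.mem_nhds hr)
      exact this.eventually_lt_const (show F ‖x₀‖ < 0 by rwa [hx₀])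
    have h2 := Measure.measure_pos_of_mem_nhds volume h1
    refine h2.ne' (measure_mono_null (fun x hx => ?_) hpos')
    exact fun h : 0 < F ‖x‖ => lt_asymm h (show F ‖x‖ < 0 from hx)
  · obtain ⟨x, h1, h2⟩ := (hpos'.and (ae_ne_zero (N := N))).exists
    exact ⟨‖x‖, norm_pos_iff.2 h2, h1⟩
  · refine ((hasDerivAt_primitive hDc hr).const_add c).congr_of_eventuallyEq ?_
    filter_upwards [isOpen_Ioi.mem_nhds hr] with t ht using hFD t ht
  · refine (hJd r hr).congr_of_eventuallyEq ?_
    filter_upwards [isOpen_Ioi.mem_nhds hr] with t ht using hDJ t ht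
  · refine hE.congr ?_
    filter_upwards [ae_restrict_of_ae hDd, ae_restrict_mem measurableSet_Ioi] with r h1 h2
    rw [h1 h2]

end HardySobolev

theorem theorem1p4 (N : ℕ) (p μ s : ℝ) (hp : 1 < p) (hpN : p < (N : ℝ))
    (hμ : μ < (((N : ℝ) - p) / p) ^ p) (hs : 0 ≤ s) (hsp : s < p) :
    -- uniqueness up to dilation
    (∀ u₁ u₂ : HardySobolev.Space N → ℝ,
      HardySobolev.IsPosRadialSol p μ s u₁ → HardySobolev.IsPosRadialSol p μ s u₂ →
        ∃ τ : ℝ, 0 < τ ∧ ∀ᵐ x, u₂ x = HardySobolev.dilation p τ u₁ x) ∧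
    -- `Γ_μ` has exactly two real zeros, and they are the exponents of the asymptotics
    ∃ γ₁ γ₂ : ℝ, γ₁ < γ₂ ∧ (∀ γ : ℝ, HardySobolev.Gam N p μ γ = 0 ↔ γ = γ₁ ∨ γ = γ₂) ∧
      (∀ u : HardySobolev.Space N → ℝ, HardySobolev.IsPosRadialSol p μ s u →
        ∃ C₁ C₂ : ℝ, 0 < C₁ ∧ 0 < C₂ ∧ HardySobolev.HasAsymptotics γ₁ γ₂ C₁ C₂ u) ∧
      -- up to dilation, the constants depend only on `N`, `p`, `μ`, `s`
      ∃ C₁ C₂ : ℝ, 0 < C₁ ∧ 0 < C₂ ∧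
        ∀ u : HardySobolev.Space N → ℝ, HardySobolev.IsPosRadialSol p μ s u →
          ∃ τ : ℝ, 0 < τ ∧
            HardySobolev.HasAsymptotics γ₁ γ₂ C₁ C₂ (HardySobolev.dilation p τ u) := by
  have hN : 0 < N := by
    have : (0 : ℝ) < N := by linarith
    exact_mod_cast this
  have : Nonempty (Fin N) := ⟨⟨0, hN⟩⟩
  exact HardySobolev.classification_of_profiles hp hpN hμ hsp fun u hu =>
    hu.exists_profile hp hpN hsp
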